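/- Let $d\ge 1$, let $T>0$ and let $\Omega\subseteq\mathbb{R}^d$ be an open set with uniformly Lipschitz boundary, i.e. there are $\varepsilon,L>0$, $M\in\mathbb{N}$ and a countable locally finite family of open sets $U_n$ covering $\partial\Omega$ such that every ball $B(x,\varepsilon)$ with $x\in\partial\Omega$ is contained in some $U_n$, no point of $\mathbb{R}^d$ belongs to more than $M$ of the $U_n$, and for each $n$ there are Cartesian coordinates $y=(y',y_d)$ and a function $f_n:\mathbb{R}^{d-1}\to\mathbb{R}$ with Lipschitz constant at most $L$ such that $U_n\cap\Omega=U_n\cap\{y_d>f_n(y')\}$. Write $L^\infty(]0,T[\times\partial\Omega)$ for $L^\infty$ with respect to $\mathscr{L}^1\otimes\mathscr{H}^{d-1}$; $\nabla$ and $\operatorname{div}$ act on the variable $x$ only. Let $C^\infty_c([0,T[\times\mathbb{R}^d)$ be the set of restrictions to $[0,T[\times\mathbb{R}^d$ of functions in $C^\infty_c(]-\infty,T[\times\mathbb{R}^d)$. Let $b\in L^\infty(]0,T[\times\Omega;\mathbb{R}^d)$ be a vector field whose distributional divergence $\operatorname{div} b$ is a locally finite (signed) Radon measure on $]0,T[\times\Omega$.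 (1) Suppose that $\operatorname{div} b$ is locally finite up to the boundary, i.e. its total variation is finite on $K\cap(]0,T[\times\Omega)$ for every compact $K\subseteq[0,T[\times\overline\Omega$. Then there is a unique $\mathrm{Tr}\,b\in L^\infty(]0,T[\times\partial\Omega)$ such that for all $\varphi\in C^\infty_c([0,T[\times\mathbb{R}^d)$ $$\int_0^T\!\!\int_{\partial\Omega}\mathrm{Tr}\,b\;\varphi\,d\mathscr{H}^{d-1}dt-\int_\Omega\varphi(0,x)\,dx=\int_0^T\!\!\int_\Omega(\partial_t\varphi+b\cdot\nabla\varphi)\,dx\,dt+\int_{]0,T[\times\Omega}\varphi\,d(\operatorname{div} b).$$ (2) Let $w,f\in L^\infty(]0,T[\times\Omega)$ satisfy $\partial_t w+\operatorname{div}(bw)=f$ in the sense of distributions, i.e. for all $\eta\in C_c^\infty(]0,T[\times\Omega)$ $$\int_0^T\!\!\int_\Omega w(\partial_t\eta+b\cdot\nabla\eta)\,dx\,dt+\int_0^T\!\!\int_\Omega f\eta\,dx\,dt=0 .$$ Then there is a unique pair of functions $\mathrm{Tr}(bw)\in L^\infty(]0,T[\times\partial\Omega)$ and $w_0\in L^\infty(\Omega)$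 such that for all $\varphi\in C^\infty_c([0,T[\times\mathbb{R}^d)$ $$\int_0^T\!\!\int_{\partial\Omega}\mathrm{Tr}(bw)\,\varphi\,d\mathscr{H}^{d-1}dt-\int_\Omega\varphi(0,x)\,w_0\,dx=\int_0^T\!\!\int_\Omega w(\partial_t\varphi+b\cdot\nabla\varphi)\,dx\,dt+\int_0^T\!\!\int_\Omega f\varphi\,dx\,dt.$$ -/

import Mathlib

open MeasureTheory Set Metric
open scoped ENNReal

/-- The open set `Ω ⊆ ℝᵈ` has uniformly Lipschitz boundary (Leoni): there are `ε, L > 0`, `M ∈ ℕ`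
and a countable locally finite family of open sets `U n` covering `∂Ω` such that
every ball `B(x, ε)` centred at `x ∈ ∂Ω` lies in one of the `U n`, no point lies in more than `M`
of the `U n`, and inside each `U n`, in suitable Cartesian coordinates `y = (y', y_d)` (the isometry
`e`), `Ω` is the open region above the graph of an `L`-Lipschitz function `f : ℝᵈ⁻¹ → ℝ`. -/
def HasUniformlyLipschitzBoundary {d : ℕ} (Ω : Set (EuclideanSpace ℝ (Fin d))) : Prop :=
  ∃ (ε : ℝ) (L : NNReal) (M : ℕ) (U : ℕ → Set (EuclideanSpace ℝ (Fin d))),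
    0 < ε ∧ 0 < L ∧
    (∀ n, IsOpen (U n)) ∧ LocallyFinite U ∧ frontier Ω ⊆ ⋃ n, U n ∧
    (∀ x ∈ frontier Ω, ∃ n, ball x ε ⊆ U n) ∧
    (∀ x, {n | x ∈ U n}.encard ≤ M) ∧
    ∀ n, ∃ (e : EuclideanSpace ℝ (Fin d) ≃ᵃⁱ[ℝ]
              WithLp 2 (EuclideanSpace ℝ (Fin (d - 1)) × ℝ))
          (f : EuclideanSpace ℝ (Fin (d - 1)) → ℝ),
      LipschitzWith L f ∧ U n ∩ Ω = U n ∩ {x | f (e x).fst < (e x).snd}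

/-- The open space-time cylinder `]0, T[ × Ω`. -/
def spaceTimeCylinder {d : ℕ} (T : ℝ) (Ω : Set (EuclideanSpace ℝ (Fin d))) :
    Set (ℝ × EuclideanSpace ℝ (Fin d)) :=
  Ioo 0 T ×ˢ Ω

/-- The measure `ℒ¹ ⊗ ℋᵈ⁻¹` on `]0, T[ × ∂Ω`, with the Hausdorff measure in its usual
normalization. -/
noncomputable def lateralMeasure {d : ℕ} (T : ℝ) (Ω : Set (EuclideanSpace ℝ (Fin d))) :
    Measure (ℝ × EuclideanSpace ℝ (Fin d)) :=
  (volume.restrict (Ioo 0 T)).prod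
    ((Measure.euclideanHausdorffMeasure (d - 1)).restrict (frontier Ω))

/-- `∂ₜ φ` at the point `z = (t, x)`. -/
noncomputable def timeDeriv {d : ℕ} (φ : ℝ × EuclideanSpace ℝ (Fin d) → ℝ)
    (z : ℝ × EuclideanSpace ℝ (Fin d)) : ℝ :=
  fderiv ℝ φ z (1, 0)

/-- `v · ∇ φ` at the point `z = (t, x)`, the gradient being taken in the variable `x` only. -/
noncomputable def spaceDeriv {d : ℕ} (φ : ℝ × EuclideanSpace ℝ (Fin d) → ℝ)
    (z : ℝ × EuclideanSpace ℝ (Fin d)) (v : EuclideanSpace ℝ (Fin d)) : ℝ :=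
  fderiv ℝ φ z (0, v)

/-- `η ∈ C_c^∞(V)`, for `V` open in `ℝ × ℝᵈ`, extended by zero. -/
def IsTestFunction {d : ℕ} (V : Set (ℝ × EuclideanSpace ℝ (Fin d)))
    (η : ℝ × EuclideanSpace ℝ (Fin d) → ℝ) : Prop :=
  ContDiff ℝ (⊤ : ℕ∞) η ∧ HasCompactSupport η ∧ tsupport η ⊆ V

/-- `φ ∈ C_c^∞([0, T[ × ℝᵈ)`: smooth up to `t = 0`, possibly nonzero there, and vanishing near
`t = T` and for large `|x|`. Such functions are the restrictions to `t ≥ 0` of the elements of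
`C_c^∞(]-∞, T[ × ℝᵈ)`, and only their values for `0 ≤ t < T` are ever used. -/
def IsTestFunctionUpToZero {d : ℕ} (T : ℝ) (φ : ℝ × EuclideanSpace ℝ (Fin d) → ℝ) : Prop :=
  IsTestFunction (Iio T ×ˢ univ) φ

/-- The measure `μ` is finite on the compact subsets of the set `V`. -/
def FiniteOnCompactsIn {X : Type*} [TopologicalSpace X] [MeasurableSpace X]
    (μ : Measure X) (V : Set X) : Prop :=
  ∀ K, IsCompact K → K ⊆ V → μ K < ∞

/-- The distributional divergence `div b`, in the variable `x` only, of the field `b` on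
`]0, T[ × Ω` is the locally finite signed Radon measure `μ⁺ - μ⁻` on `]0, T[ × Ω`. A locally finite
signed measure is given as a difference of two nonnegative ones, finite on compact subsets
of `]0, T[ × Ω`; their values outside `]0, T[ × Ω` play no role. -/
def HasSpaceDivergence {d : ℕ} (T : ℝ) (Ω : Set (EuclideanSpace ℝ (Fin d)))
    (b : ℝ × EuclideanSpace ℝ (Fin d) → EuclideanSpace ℝ (Fin d))
    (μp μn : Measure (ℝ × EuclideanSpace ℝ (Fin d))) : Prop :=
  FiniteOnCompactsIn μp (spaceTimeCylinder T Ω) ∧ FiniteOnCompactsIn μn (spaceTimeCylinder T Ω) ∧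
  ∀ η, IsTestFunction (spaceTimeCylinder T Ω) η →
    - ∫ z in spaceTimeCylinder T Ω, spaceDeriv η z (b z) =
      (∫ z in spaceTimeCylinder T Ω, η z ∂μp) - ∫ z in spaceTimeCylinder T Ω, η z ∂μn

/-- The measure `μ` on `]0, T[ × Ω` is locally finite in `[0, T[ × closure Ω`, i.e. up to
`t = 0` and up to `∂Ω`. -/
def LocallyFiniteUpToBoundary {d : ℕ} (T : ℝ) (Ω : Set (EuclideanSpace ℝ (Fin d)))
    (μ : Measure (ℝ × EuclideanSpace ℝ (Fin d))) : Prop :=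
  FiniteOnCompactsIn (μ.restrict (spaceTimeCylinder T Ω)) (Ico 0 T ×ˢ closure Ω)

/-- `∂ₜ w + div (b w) = f` in the sense of distributions on `]0, T[ × Ω`. -/
def IsDistributionalSolution {d : ℕ} (T : ℝ) (Ω : Set (EuclideanSpace ℝ (Fin d)))
    (b : ℝ × EuclideanSpace ℝ (Fin d) → EuclideanSpace ℝ (Fin d))
    (w f : ℝ × EuclideanSpace ℝ (Fin d) → ℝ) : Prop :=
  ∀ η, IsTestFunction (spaceTimeCylinder T Ω) η →
    (∫ z in spaceTimeCylinder T Ω, w z * (timeDeriv η z + spaceDeriv η z (b z)))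
      + ∫ z in spaceTimeCylinder T Ω, f z * η z = 0

/-! ### Bounded functionals on `L¹`, and functionals dominated by an `L¹` seminorm. -/

section Duality

variable {α : Type*} [MeasurableSpace α]

/-! Both parts concern a space-time flux `B` on the cylinder, paired with test functions together
with its sources: `B = (0, b)` with source `div b` in (1), `B = (w, w b)` with source `f` in (2). In
the interior the pairing vanishes. For `φ` that need not vanish at `t = 0` or on `∂Ω`, it is a
linear functional of `φ`, and the traces are the `L^∞` densities representing it. Everything rests
on one estimate: the pairing is at most a constant times `‖w‖_∞ ∫_Ω |φ(0,·)| + ‖w b‖_∞ ∫ |φ| d(ℒ¹ ⊗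
ℋᵈ⁻¹)`, with the first term absent in case (1).

For the estimate, take smooth cutoffs `κ` rising from 0 to 1 in a layer of width of order `δ` along
`{t = 0}` and `∂Ω`. Testing with `κ φ` gives 0, so by the product rule the pairing weighted by `κ`
equals `-∫ φ Dκ(B)`. As `δ → 0` the left side tends to the full pairing. On the right `Dκ` is of
order `1/δ`, its time part living in the initial layer and its space part in the lateral one. Since
`φ` is uniformly continuous, the integral of `|φ|` over a layer is at most `δ` times its boundary
integral plus a small error. The factors `δ` cancel. The Lipschitz charts enter only in the lateral
layer bound (`exists_lintegral_thickening_frontier_le`), through graphs over flat bases; no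
divergence theorem or area formula is needed.

By Hahn–Banach and `(L¹)* = L^∞` the functional is integration against a bounded density: over the
lateral boundary in (1), over the lateral boundary and the initial face together in (2). In (1) the
term `∂ₜφ` is integrated explicitly and yields `-∫_Ω φ(0,·)`. Uniqueness follows by testing first
with `φ` supported in `t > 0`, then with products `a(t) g(x)` where `a(0) = 1`. -/

theorem exists_memLp_top_repr_of_finite (μ : Measure α) [IsFiniteMeasure μ]
    (F : Lp ℝ 1 μ →L[ℝ] ℝ) :
    ∃ G : α → ℝ, MemLp G ∞ μ ∧ ∀ u : Lp ℝ 1 μ, F u = ∫ x, G x * u x ∂μ := by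
  have h12 : ∀ u : Lp ℝ 2 μ, MemLp u 1 μ := fun u =>
    (Lp.memLp u).mono_exponent (by norm_num)
  let J : Lp ℝ 2 μ →ₗ[ℝ] Lp ℝ 1 μ :=
    { toFun := fun u => (h12 u).toLp u
      map_add' := fun u v => by
        rw [← MemLp.toLp_add, MemLp.toLp_eq_toLp_iff]
        exact Lp.coeFn_add u v
      map_smul' := fun c u => by
        rw [RingHom.id_apply, ← MemLp.toLp_const_smul, MemLp.toLp_eq_toLp_iff]
        exact Lp.coeFn_smul c u }
  have hJ : ∀ u, ‖J u‖ ≤ ((μ univ) ^ (1 - 1 / 2 : ℝ)).toReal * ‖u‖ := by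
    intro u
    have h := eLpNorm_le_eLpNorm_mul_rpow_measure_univ (μ := μ) (p := 1) (q := 2) (f := u)
      (by norm_num) (Lp.memLp u).1
    simp only [ENNReal.toReal_one, ENNReal.toReal_ofNat] at h
    have h2 := ENNReal.toReal_mono (ENNReal.mul_ne_top (Lp.eLpNorm_ne_top u)
      (ENNReal.rpow_ne_top_of_nonneg (by norm_num) (measure_ne_top _ _))) h
    rw [ENNReal.toReal_mul, mul_comm] at h2
    have : ‖J u‖ = (eLpNorm u 1 μ).toReal := by
      simp only [J, LinearMap.coe_mk, AddHom.coe_mk, Lp.norm_toLp]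
    rw [this, Lp.norm_def]
    simpa using h2
  let Jc : Lp ℝ 2 μ →L[ℝ] Lp ℝ 1 μ := J.mkContinuous _ hJ
  -- Since `μ` is finite, `L²` embeds in `L¹`, and the Riesz theorem in `L²` already produces the
  -- density.
  let g : Lp ℝ 2 μ := (InnerProductSpace.toDual ℝ (Lp ℝ 2 μ)).symm (F.comp Jc)
  have hg : ∀ u : Lp ℝ 2 μ, F (J u) = ∫ x, g x * u x ∂μ := by
    intro u
    have : F (J u) = (F.comp Jc) u := rfl
    rw [this, ← InnerProductSpace.toDual_symm_apply (𝕜 := ℝ), L2.inner_def]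
    refine integral_congr_ae (Filter.Eventually.of_forall fun x => ?_)
    simp [g, mul_comm]
  have hind : ∀ s (hs : MeasurableSet s), F (indicatorConstLp 1 hs (measure_ne_top μ s) 1)
      = ∫ x in s, g x ∂μ := by
    intro s hs
    have h1 : J (indicatorConstLp 2 hs (measure_ne_top μ s) 1)
        = indicatorConstLp 1 hs (measure_ne_top μ s) 1 := by
      simp only [J, LinearMap.coe_mk, AddHom.coe_mk, indicatorConstLp]
      rw [MemLp.toLp_eq_toLp_iff]
      exact MemLp.coeFn_toLp _
    rw [← h1, hg, ← integral_indicator hs]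
    refine integral_congr_ae ?_
    filter_upwards [indicatorConstLp_coeFn (p := 2) (hs := hs) (hμs := measure_ne_top μ s)
      (c := (1 : ℝ))] with x hx
    rw [hx]
    by_cases h : x ∈ s <;> simp [h]
  have hgi : Integrable g μ := (h12 g).integrable le_rfl
  -- Testing `F` on indicators bounds every average of `g` by `‖F‖`, which upgrades `g` from `L²` to
  -- `L^∞`.
  have hbd : ∀ s, MeasurableSet s → |∫ x in s, g x ∂μ| ≤ ‖F‖ * μ.real s := by
    intro s hs
    rw [← hind s hs, ← Real.norm_eq_abs]
    refine (F.le_opNorm _).trans_eq ?_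
    rw [norm_indicatorConstLp (by norm_num) (by norm_num)]
    simp
  have hle : ∀ᵐ x ∂μ, g x ≤ ‖F‖ := by
    refine ae_le_of_forall_setIntegral_le hgi (integrable_const _) fun s hs _ => ?_
    rw [setIntegral_const, smul_eq_mul, mul_comm]
    exact (le_abs_self _).trans (hbd s hs)
  have hge : ∀ᵐ x ∂μ, -‖F‖ ≤ g x := by
    refine ae_le_of_forall_setIntegral_le (integrable_const _) hgi fun s hs _ => ?_
    rw [setIntegral_const, smul_eq_mul, mul_comm, neg_mul]
    exact neg_le_of_abs_le (hbd s hs)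
  have hgb : ∀ᵐ x ∂μ, ‖g x‖ ≤ ‖F‖ := by
    filter_upwards [hle, hge] with x h1 h2
    exact abs_le.2 ⟨h2, h1⟩
  have hgm : MemLp g ∞ μ := memLp_top_of_bound hgi.1 _ hgb
  have hint : ∀ u : Lp ℝ 1 μ, Integrable (fun x => g x * u x) μ := fun u =>
    (L1.integrable_coeFn u).bdd_mul hgi.1 hgb
  refine ⟨g, hgm, fun u => ?_⟩
  let G : Lp ℝ 1 μ →ₗ[ℝ] ℝ :=
    { toFun := fun u => ∫ x, g x * u x ∂μ
      map_add' := fun u v => by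
        rw [← integral_add (hint u) (hint v)]
        refine integral_congr_ae ?_
        filter_upwards [Lp.coeFn_add u v] with x hx
        rw [hx, Pi.add_apply, mul_add]
      map_smul' := fun c u => by
        rw [RingHom.id_apply, smul_eq_mul, ← integral_const_mul]
        refine integral_congr_ae ?_
        filter_upwards [Lp.coeFn_smul c u] with x hx
        rw [hx, Pi.smul_apply, smul_eq_mul]
        ring }
  have hGb : ∀ u, ‖G u‖ ≤ ‖F‖ * ‖u‖ := by
    intro u
    simp only [G, LinearMap.coe_mk, AddHom.coe_mk]
    rw [L1.norm_eq_integral_norm, ← integral_const_mul]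
    refine norm_integral_le_of_norm_le ((L1.integrable_coeFn u).norm.const_mul _) ?_
    filter_upwards [hgb] with x hx
    rw [norm_mul]
    gcongr
  let Gc : Lp ℝ 1 μ →L[ℝ] ℝ := G.mkContinuous _ hGb
  have : F u = Gc u := by
    refine Lp.induction (p := 1) (by norm_num) (motive := fun u => F u = Gc u) ?_ ?_ ?_ u
    · intro c s hs hμs
      have hc : (Lp.simpleFunc.indicatorConst 1 hs hμs.ne c : Lp ℝ 1 μ)
          = c • indicatorConstLp 1 hs (measure_ne_top μ s) (1 : ℝ) := by
        rw [Lp.simpleFunc.coe_indicatorConst]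
        ext1
        refine (indicatorConstLp_coeFn).trans ?_
        refine Filter.EventuallyEq.trans ?_ (Lp.coeFn_smul _ _).symm
        filter_upwards [indicatorConstLp_coeFn (p := 1) (hs := hs) (hμs := measure_ne_top μ s)
          (c := (1 : ℝ))] with x hx
        rw [Pi.smul_apply, hx]
        by_cases h : x ∈ s <;> simp [h]
      rw [hc, map_smul, map_smul, hind s hs]
      congr 1
      change _ = ∫ x, g x * (indicatorConstLp 1 hs (measure_ne_top μ s) (1 : ℝ) : Lp ℝ 1 μ) x ∂μ
      rw [← integral_indicator hs]
      refine integral_congr_ae ?_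
      filter_upwards [indicatorConstLp_coeFn (p := 1) (hs := hs) (hμs := measure_ne_top μ s)
          (c := (1 : ℝ))] with x hx
      rw [hx]
      by_cases h : x ∈ s <;> simp [h]
    · intro f g hf hg _ h1 h2
      rw [map_add, map_add, h1, h2]
    · exact isClosed_eq F.continuous Gc.continuous
  exact this

/-- For a positive `ν`-integrable `ρ`, multiplication by `ρ` is an isometry from `L¹(ρν)` to
`L¹(ν)`, which reduces to a finite measure. As `ν ≪ ρν`, the density found for `ρν` is essentially
bounded for `ν` and serves unchanged. -/
theorem exists_memLp_top_repr (ν : Measure α) [SigmaFinite ν] (F : Lp ℝ 1 ν →L[ℝ] ℝ) :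
    ∃ G : α → ℝ, MemLp G ∞ ν ∧ ∀ u : Lp ℝ 1 ν, F u = ∫ x, G x * u x ∂ν := by
  obtain ⟨ρ, hρ0, hρm, hρi⟩ := exists_pos_lintegral_lt_of_sigmaFinite ν (ε := 1) one_ne_zero
  have hfin : IsFiniteMeasure (ν.withDensity fun x => (ρ x : ℝ≥0∞)) :=
    isFiniteMeasure_withDensity (hρi.trans ENNReal.one_lt_top).ne
  have hac : ν ≪ ν.withDensity fun x => (ρ x : ℝ≥0∞) :=
    withDensity_absolutelyContinuous' (by fun_prop)
      (Filter.Eventually.of_forall fun x => by simpa using (hρ0 x).ne')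
  obtain ⟨G, hG, hrep⟩ := exists_memLp_top_repr_of_finite _
    (F.comp (withDensitySMulLI ν (E := ℝ) hρm).toContinuousLinearMap)
  refine ⟨G, ⟨hG.1.mono_ac hac, (eLpNormEssSup_mono_measure _ hac).trans_lt hG.2⟩, fun u => ?_⟩
  have hui : Integrable (fun x => (ρ x : ℝ)⁻¹ * u x) (ν.withDensity fun x => (ρ x : ℝ≥0∞)) := by
    rw [integrable_withDensity_iff_integrable_smul hρm]
    refine (L1.integrable_coeFn u).congr (Filter.Eventually.of_forall fun x => ?_)
    have := (hρ0 x).ne'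
    simp only [NNReal.smul_def, smul_eq_mul]
    field_simp
  have hu : withDensitySMulLI ν (E := ℝ) hρm (hui.toL1 _) = u := by
    rw [withDensitySMulLI_apply]
    ext1
    refine (MemLp.coeFn_toLp _).trans ?_
    filter_upwards [hac.ae_eq hui.coeFn_toL1] with x hx
    have := (hρ0 x).ne'
    simp only [hx, NNReal.smul_def, smul_eq_mul]
    field_simp
  have h := hrep (hui.toL1 _)
  simp only [ContinuousLinearMap.comp_apply, LinearIsometry.coe_toContinuousLinearMap, hu] at h
  rw [h, integral_withDensity_eq_integral_smul hρm]
  refine integral_congr_ae ?_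
  filter_upwards [hac.ae_eq hui.coeFn_toL1] with x hx
  have := (hρ0 x).ne'
  simp only [hx, NNReal.smul_def, smul_eq_mul]
  field_simp

/-- The bound makes `Λ` factor through the range of `ι`, where it is continuous; Hahn–Banach extends
it to `L¹`. Injectivity of `ι` is not needed, which matters because distinct test functions may
agree on the boundary. -/
theorem exists_memLp_top_repr_of_le {V : Type*} [AddCommGroup V] [Module ℝ V]
    (ν : Measure α) [SigmaFinite ν] (ι : V →ₗ[ℝ] Lp ℝ 1 ν) (Λ : V →ₗ[ℝ] ℝ) (C : ℝ)
    (h : ∀ v, |Λ v| ≤ C * ‖ι v‖) :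
    ∃ G : α → ℝ, MemLp G ∞ ν ∧ ∀ v, Λ v = ∫ x, G x * ι v x ∂ν := by
  obtain ⟨s, hs⟩ := ι.rangeRestrict.exists_rightInverse_of_surjective ι.range_rangeRestrict
  have hs' : ∀ y, ι (s y) = y := fun y => congrArg Subtype.val (LinearMap.congr_fun hs y)
  let Λ' : StrongDual ℝ (LinearMap.range ι) := (Λ ∘ₗ s).mkContinuous C fun y => by
    have := h (s y)
    rwa [hs'] at this
  obtain ⟨F, hF, -⟩ := _root_.exists_extension_norm_eq (LinearMap.range ι) Λ'
  obtain ⟨G, hG, hrep⟩ := exists_memLp_top_repr ν F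
  refine ⟨G, hG, fun v => ?_⟩
  rw [← hrep]
  have h1 := hF (ι.rangeRestrict v)
  -- The chosen preimage and `v` differ by an element of the kernel of `ι`, on which the bound
  -- forces `Λ` to vanish.
  have h2 := h (s (ι.rangeRestrict v) - v)
  have h0 : ι (s (ι.rangeRestrict v) - v) = 0 := by
    rw [map_sub, hs']
    exact sub_self (ι v)
  rw [h0, norm_zero, mul_zero, map_sub] at h2
  have h3 := sub_eq_zero.1 (abs_nonpos_iff.1 h2)
  rw [← h3]
  exact h1.symm

end Duality

/-! ### Lipschitz graphs: coordinates, surface measure and thin layers. -/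

section Graph

variable {d : ℕ}

theorem euclideanHausdorffMeasure_image_le_of_lipschitzOnWith {X Y : Type*} [EMetricSpace X]
    [EMetricSpace Y] [MeasurableSpace X] [BorelSpace X] [MeasurableSpace Y] [BorelSpace Y]
    {K : NNReal} {f : X → Y} {s : Set X} (hf : LipschitzOnWith K f s) (n : ℕ) :
    Measure.euclideanHausdorffMeasure n (f '' s)
      ≤ (K : ℝ≥0∞) ^ n * Measure.euclideanHausdorffMeasure n s := by
  simp_rw [Measure.euclideanHausdorffMeasure_def, Measure.smul_apply]
  rw [mul_smul_comm]
  gcongr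
  simpa using hf.hausdorffMeasure_image_le (d := n) (by positivity)

/-- The point with coordinates `(y, s)` in the Cartesian coordinate system `e`. -/
noncomputable def coordPoint
    (e : EuclideanSpace ℝ (Fin d) ≃ᵃⁱ[ℝ] WithLp 2 (EuclideanSpace ℝ (Fin (d - 1)) × ℝ))
    (y : EuclideanSpace ℝ (Fin (d - 1))) (s : ℝ) : EuclideanSpace ℝ (Fin d) :=
  e.symm (WithLp.toLp 2 (y, s))

variable (e : EuclideanSpace ℝ (Fin d) ≃ᵃⁱ[ℝ] WithLp 2 (EuclideanSpace ℝ (Fin (d - 1)) × ℝ))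

@[simp]
theorem apply_coordPoint_fst (y : EuclideanSpace ℝ (Fin (d - 1))) (s : ℝ) :
    (e (coordPoint e y s)).fst = y := by
  simp [coordPoint]

@[simp]
theorem apply_coordPoint_snd (y : EuclideanSpace ℝ (Fin (d - 1))) (s : ℝ) :
    (e (coordPoint e y s)).snd = s := by
  simp [coordPoint]

@[simp]
theorem coordPoint_apply (x : EuclideanSpace ℝ (Fin d)) :
    coordPoint e (e x).fst (e x).snd = x := by
  simp only [coordPoint]
  rw [AffineIsometryEquiv.symm_apply_eq]
  rfl

theorem dist_coordPoint_le (y y' : EuclideanSpace ℝ (Fin (d - 1))) (s s' : ℝ) :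
    dist (coordPoint e y s) (coordPoint e y' s') ≤ dist y y' + dist s s' := by
  rw [coordPoint, coordPoint, e.symm.dist_map, WithLp.prod_dist_eq_of_L2]
  refine Real.sqrt_le_iff.2 ⟨by positivity, ?_⟩
  simp only [WithLp.toLp_fst, WithLp.toLp_snd]
  nlinarith [dist_nonneg (x := y) (y := y'), dist_nonneg (x := s) (y := s')]

theorem dist_fst_apply_le (x x' : EuclideanSpace ℝ (Fin d)) :
    dist (e x).fst (e x').fst ≤ dist x x' := by
  rw [← e.dist_map x x']
  exact WithLp.dist_fst_le _ _

theorem dist_snd_apply_le (x x' : EuclideanSpace ℝ (Fin d)) :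
    dist (e x).snd (e x').snd ≤ dist x x' := by
  rw [← e.dist_map x x']
  exact WithLp.dist_snd_le _ _

theorem continuous_coordPoint :
    Continuous fun p : EuclideanSpace ℝ (Fin (d - 1)) × ℝ => coordPoint e p.1 p.2 := by
  unfold coordPoint
  exact e.symm.continuous.comp (WithLp.prod_continuous_toLp 2 _ _)

/-- Isometries preserve Hausdorff measure, which is volume in the top dimension. The dimension of
the product is read off from `e`, since `d - 1 + 1 = d` fails for truncated subtraction at `d = 0`.
-/
theorem measurePreserving_coordPoint :
    MeasurePreserving
      (fun p : EuclideanSpace ℝ (Fin (d - 1)) × ℝ => coordPoint e p.1 p.2) := by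
  have h := e.symm.toIsometryEquiv.measurePreserving_euclideanHausdorffMeasure d
  have hE : Module.finrank ℝ (EuclideanSpace ℝ (Fin d)) = d := by simp
  have hW : Module.finrank ℝ (WithLp 2 (EuclideanSpace ℝ (Fin (d - 1)) × ℝ)) = d := by
    rw [← e.linearIsometryEquiv.toLinearEquiv.finrank_eq, hE]
  have h1 := InnerProductSpace.euclideanHausdorffMeasure_eq_volume
    (V := WithLp 2 (EuclideanSpace ℝ (Fin (d - 1)) × ℝ))
  rw [hW] at h1
  rw [h1, EuclideanSpace.euclideanHausdorffMeasure_eq_volume] at h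
  exact h.comp (WithLp.volume_preserving_toLp _ _)

theorem lintegral_eq_lintegral_coordPoint {H : EuclideanSpace ℝ (Fin d) → ℝ≥0∞}
    (hH : Measurable H) :
    ∫⁻ x, H x = ∫⁻ y, ∫⁻ s, H (coordPoint e y s) := by
  rw [← (measurePreserving_coordPoint e).lintegral_comp hH, Measure.volume_eq_prod,
    lintegral_prod]
  exact (hH.comp (measurePreserving_coordPoint e).measurable).aemeasurable

variable {e} {f : EuclideanSpace ℝ (Fin (d - 1)) → ℝ} {L : NNReal}

theorem lipschitzWith_coordPoint_graph (hf : LipschitzWith L f) :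
    LipschitzWith (1 + L) fun y => coordPoint e y (f y) := by
  refine LipschitzWith.of_dist_le_mul fun y y' => (dist_coordPoint_le e _ _ _ _).trans ?_
  have := hf.dist_le_mul y y'
  push_cast
  linarith

/-- The projection to the base is 1-Lipschitz and inverts the graph parametrization, so it cannot
increase Hausdorff measure. This one-sided comparison replaces the area formula. -/
theorem map_coordPoint_graph_le (hf : LipschitzWith L f) :
    Measure.map (fun y => coordPoint e y (f y)) volume
      ≤ Measure.euclideanHausdorffMeasure (d - 1) := by
  have hγ := (lipschitzWith_coordPoint_graph (e := e) hf).continuous.measurable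
  refine Measure.le_iff.2 fun A hA => ?_
  rw [Measure.map_apply hγ hA, ← EuclideanSpace.euclideanHausdorffMeasure_eq_volume]
  have hπ : LipschitzWith 1 fun x => (e x).fst :=
    LipschitzWith.of_dist_le_mul fun x x' => by simpa using dist_fst_apply_le e x x'
  refine (measure_mono ?_).trans ((euclideanHausdorffMeasure_image_le_of_lipschitzOnWith
    (hπ.lipschitzOnWith (s := A)) (d - 1)).trans_eq (by simp))
  exact fun y hy => ⟨_, hy, by simp⟩

/-- The layer of width `δ` above the graph of `f` in the coordinates `e`. -/
def graphLayer
    (e : EuclideanSpace ℝ (Fin d) ≃ᵃⁱ[ℝ] WithLp 2 (EuclideanSpace ℝ (Fin (d - 1)) × ℝ))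
    (f : EuclideanSpace ℝ (Fin (d - 1)) → ℝ) (δ : ℝ) : Set (EuclideanSpace ℝ (Fin d)) :=
  {x | f (e x).fst < (e x).snd ∧ (e x).snd < f (e x).fst + δ}

theorem measurableSet_graphLayer (hf : Continuous f) (δ : ℝ) :
    MeasurableSet (graphLayer e f δ) := by
  have h1 : Continuous fun x => (e x).fst := (WithLp.continuous_fst 2 _ _).comp e.continuous
  have h2 : Continuous fun x => (e x).snd := (WithLp.continuous_snd 2 _ _).comp e.continuous
  exact ((isOpen_lt (hf.comp h1) h2).inter
    (isOpen_lt h2 ((hf.comp h1).add continuous_const))).measurableSet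

/-- Each vertical fibre of the layer has length `δ`, and on it `H` is uniformly close to its value
at the graph point below. Fubini then gives the bound. -/
theorem exists_lintegral_graphLayer_le (hf : LipschitzWith L f) {T : ℝ}
    {H : ℝ × EuclideanSpace ℝ (Fin d) → ℝ} (hH : Continuous H) (hHc : HasCompactSupport H)
    {η : ℝ≥0∞} (hη : η ≠ 0) :
    ∃ δ₀ > 0, ∀ δ, 0 < δ → δ < δ₀ →
      ∫⁻ t in Ioo 0 T, ∫⁻ x in graphLayer e f δ, ‖H (t, x)‖ₑ ≤
        ENNReal.ofReal δ * ((∫⁻ t in Ioo 0 T, ∫⁻ y, ‖H (t, coordPoint e y (f y))‖ₑ) + η) := by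
  obtain ⟨R, hR⟩ := hHc.isCompact.isBounded.subset_closedBall 0
  set B : Set (EuclideanSpace ℝ (Fin (d - 1))) := closedBall (e 0).fst R with hB
  have hBm : MeasurableSet B := measurableSet_closedBall
  have hBfin : (volume (Ioo (0 : ℝ) T) * volume B : ℝ≥0∞) ≠ ∞ :=
    ENNReal.mul_ne_top (by simp) (isCompact_closedBall _ _).measure_lt_top.ne
  -- `ω` is the allowed oscillation of `H`; integrated over `]0,T[ × B`, with `B` containing the
  -- base projection of the support, it must stay below `η`.
  obtain ⟨ω, hω, hωη⟩ := ENNReal.exists_nnreal_pos_mul_lt hBfin hη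
  obtain ⟨δ₀, hδ₀, hUC⟩ := Metric.uniformContinuous_iff.1
    (hHc.uniformContinuous_of_continuous hH) ω (by exact_mod_cast hω)
  refine ⟨δ₀, hδ₀, fun δ hδ hδδ => ?_⟩
  have hsupp : ∀ t x, (e x).fst ∉ B → H (t, x) = 0 := by
    intro t x hx
    by_contra h
    apply hx
    have h1 := hR (subset_tsupport _ h)
    rw [mem_closedBall] at h1 ⊢
    refine (dist_fst_apply_le e x 0).trans (le_trans ?_ h1)
    rw [Prod.dist_eq]
    exact le_max_right _ _
  have key : ∀ t y s, s ∈ Ioo (f y) (f y + δ) → ‖H (t, coordPoint e y s)‖ₑ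
      ≤ ‖H (t, coordPoint e y (f y))‖ₑ + B.indicator (fun _ => (ω : ℝ≥0∞)) y := by
    intro t y s hs
    by_cases hy : y ∈ B
    · rw [indicator_of_mem hy]
      have h1 : dist (t, coordPoint e y s) (t, coordPoint e y (f y)) < δ₀ := by
        rw [dist_prod_same_left]
        refine (dist_coordPoint_le e _ _ _ _).trans_lt ?_
        rw [dist_self, zero_add, Real.dist_eq, abs_of_pos (by linarith [hs.1])]
        linarith [hs.2]
      have h2 := hUC h1
      have h3 : ‖H (t, coordPoint e y s) - H (t, coordPoint e y (f y))‖ₑ ≤ (ω : ℝ≥0∞) := by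
        rw [enorm_eq_nnnorm]
        rw [dist_eq_norm] at h2
        exact_mod_cast h2.le
      calc ‖H (t, coordPoint e y s)‖ₑ
          = ‖H (t, coordPoint e y (f y))
            + (H (t, coordPoint e y s) - H (t, coordPoint e y (f y)))‖ₑ := by congr 1; ring
        _ ≤ _ := (enorm_add_le _ _).trans (by gcongr)
    · rw [hsupp t _ (by simpa using hy)]
      simp
  have hinner : ∀ t, ∫⁻ x in graphLayer e f δ, ‖H (t, x)‖ₑ ≤
      ENNReal.ofReal δ * ((∫⁻ y, ‖H (t, coordPoint e y (f y))‖ₑ) + ω * volume B) := by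
    intro t
    have hmeas : Measurable fun x => ‖H (t, x)‖ₑ :=
      (hH.comp (Continuous.prodMk_right t)).enorm.measurable
    rw [← lintegral_indicator (measurableSet_graphLayer hf.continuous δ),
      lintegral_eq_lintegral_coordPoint e
        (hmeas.indicator (measurableSet_graphLayer hf.continuous δ))]
    calc ∫⁻ y, ∫⁻ s, (graphLayer e f δ).indicator (fun x => ‖H (t, x)‖ₑ) (coordPoint e y s)
        ≤ ∫⁻ y, ENNReal.ofReal δ * (‖H (t, coordPoint e y (f y))‖ₑ
            + B.indicator (fun _ => (ω : ℝ≥0∞)) y) := by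
          refine lintegral_mono fun y => ?_
          calc ∫⁻ s, (graphLayer e f δ).indicator (fun x => ‖H (t, x)‖ₑ) (coordPoint e y s)
              ≤ ∫⁻ s, (Ioo (f y) (f y + δ)).indicator
                (fun _ => ‖H (t, coordPoint e y (f y))‖ₑ
                  + B.indicator (fun _ => (ω : ℝ≥0∞)) y) s := by
                refine lintegral_mono fun s => ?_
                by_cases hs : s ∈ Ioo (f y) (f y + δ)
                · rw [indicator_of_mem hs]
                  exact (indicator_le_self _ _ _).trans (key t y s hs)
                · rw [indicator_of_notMem hs, indicator_of_notMem]
                  simpa [graphLayer] using hs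
            _ = _ := by
                rw [lintegral_indicator measurableSet_Ioo, setLIntegral_const, Real.volume_Ioo,
                  add_sub_cancel_left, mul_comm]
      _ = _ := by
          have h1 : Measurable fun y => ‖H (t, coordPoint e y (f y))‖ₑ := by
            have h := (lipschitzWith_coordPoint_graph (e := e) hf).continuous
            exact (hH.comp (continuous_const.prodMk h)).enorm.measurable
          rw [lintegral_const_mul' _ _ ENNReal.ofReal_ne_top,
            lintegral_add_left h1, lintegral_indicator hBm, setLIntegral_const]
  calc ∫⁻ t in Ioo 0 T, ∫⁻ x in graphLayer e f δ, ‖H (t, x)‖ₑ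
      ≤ ∫⁻ t in Ioo 0 T, ENNReal.ofReal δ *
          ((∫⁻ y, ‖H (t, coordPoint e y (f y))‖ₑ) + ω * volume B) := lintegral_mono hinner
    _ = ENNReal.ofReal δ * ((∫⁻ t in Ioo 0 T, ∫⁻ y, ‖H (t, coordPoint e y (f y))‖ₑ)
          + ω * (volume (Ioo (0 : ℝ) T) * volume B)) := by
        rw [lintegral_const_mul' _ _ ENNReal.ofReal_ne_top, lintegral_add_right _ measurable_const,
          setLIntegral_const]
        congr 2
        ring
    _ ≤ _ := by gcongr

variable {Ω U : Set (EuclideanSpace ℝ (Fin d))}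

/-- Inside the open set `U` the frontier of `Ω` is that of the supergraph, and by continuity the
latter lies in the graph. -/
theorem snd_eq_of_mem_frontier (hU : IsOpen U) (hf : Continuous f)
    (hΩU : U ∩ Ω = U ∩ {x | f (e x).fst < (e x).snd}) {x : EuclideanSpace ℝ (Fin d)} (hxU : x ∈ U)
    (hx : x ∈ frontier Ω) : (e x).snd = f (e x).fst := by
  have h1 : Continuous fun x => (e x).fst := (WithLp.continuous_fst 2 _ _).comp e.continuous
  have h2 : Continuous fun x => (e x).snd := (WithLp.continuous_snd 2 _ _).comp e.continuous
  have hx' : x ∈ frontier {x | f (e x).fst < (e x).snd} := by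
    have h3 : x ∈ U ∩ frontier (U ∩ Ω) := by
      rw [inter_comm U Ω]
      rw [inter_comm, frontier_inter_open_inter hU]
      exact ⟨hx, hxU⟩
    rw [hΩU, inter_comm U, inter_comm U, frontier_inter_open_inter hU] at h3
    exact h3.1
  exact (frontier_lt_subset_eq (hf.comp h1) h2 hx').symm

theorem coordPoint_graph_mem_frontier (hU : IsOpen U)
    (hΩU : U ∩ Ω = U ∩ {x | f (e x).fst < (e x).snd}) {y : EuclideanSpace ℝ (Fin (d - 1))}
    (hy : coordPoint e y (f y) ∈ U) : coordPoint e y (f y) ∈ frontier Ω := by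
  have hmem : ∀ x ∈ U, (x ∈ Ω ↔ f (e x).fst < (e x).snd) := by
    intro x hx
    have := Set.ext_iff.1 hΩU x
    simpa [hx] using this
  refine ⟨?_, fun h => ?_⟩
  · have hc : Continuous fun s => coordPoint e y s :=
      (continuous_coordPoint e).comp (Continuous.prodMk_right y)
    refine mem_closure_of_tendsto (b := nhdsWithin (f y) (Ioi (f y)))
      (f := fun s => coordPoint e y s) (hc.continuousAt.tendsto.mono_left nhdsWithin_le_nhds) ?_
    have h1 : ∀ᶠ s in nhdsWithin (f y) (Ioi (f y)), coordPoint e y s ∈ U :=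
      nhdsWithin_le_nhds (hc.continuousAt.eventually_mem (hU.mem_nhds hy))
    filter_upwards [h1, self_mem_nhdsWithin] with s hs hs'
    rw [hmem _ hs]
    simpa using hs'
  · have := (hmem _ hy).1 (interior_subset h)
    simp at this

/-- Near each of its points the frontier lies in the Lipschitz image of a ball of the base. -/
theorem isLocallyFiniteMeasure_hausdorff_frontier (hLip : HasUniformlyLipschitzBoundary Ω) :
    IsLocallyFiniteMeasure
      ((Measure.euclideanHausdorffMeasure (d - 1)).restrict (frontier Ω)) := by
  obtain ⟨ε, L, M, U, hε, hL, hUo, -, hcov, -, -, hchart⟩ := hLip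
  refine ⟨fun x => ?_⟩
  by_cases hx : x ∈ frontier Ω
  · obtain ⟨n, hn⟩ := mem_iUnion.1 (hcov hx)
    obtain ⟨e, f, hf, hΩU⟩ := hchart n
    refine ⟨U n ∩ ball x 1, Filter.inter_mem ((hUo n).mem_nhds hn) (ball_mem_nhds x one_pos), ?_⟩
    rw [Measure.restrict_apply ((hUo n).inter isOpen_ball).measurableSet]
    have hsub : (U n ∩ ball x 1) ∩ frontier Ω
        ⊆ (fun y => coordPoint e y (f y)) '' closedBall (e x).fst 1 := by
      rintro z ⟨⟨hzU, hzb⟩, hz⟩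
      refine ⟨(e z).fst, mem_closedBall.2 ((dist_fst_apply_le e z x).trans hzb.le), ?_⟩
      simp only
      rw [← snd_eq_of_mem_frontier (hUo n) hf.continuous hΩU hzU hz, coordPoint_apply]
    refine (measure_mono hsub).trans_lt ?_
    refine (euclideanHausdorffMeasure_image_le_of_lipschitzOnWith
      (lipschitzWith_coordPoint_graph (e := e) hf).lipschitzOnWith (d - 1)).trans_lt ?_
    rw [EuclideanSpace.euclideanHausdorffMeasure_eq_volume]
    exact ENNReal.mul_lt_top (by simp) (isCompact_closedBall _ _).measure_lt_top
  · refine ⟨(frontier Ω)ᶜ, isClosed_frontier.isOpen_compl.mem_nhds hx, ?_⟩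
    rw [Measure.restrict_apply isClosed_frontier.measurableSet.compl]
    simp

end Graph

/-! ### The lateral layer near `∂Ω`, controlled by the lateral measure. -/

section Layer

variable {d : ℕ} {Ω : Set (EuclideanSpace ℝ (Fin d))}

theorem isLocallyFiniteMeasure_lateralMeasure (hLip : HasUniformlyLipschitzBoundary Ω) (T : ℝ) :
    IsLocallyFiniteMeasure (lateralMeasure T Ω) := by
  have := isLocallyFiniteMeasure_hausdorff_frontier hLip
  unfold lateralMeasure
  infer_instance

theorem lintegral_lateralMeasure (hLip : HasUniformlyLipschitzBoundary Ω) (T : ℝ)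
    {H : ℝ × EuclideanSpace ℝ (Fin d) → ℝ≥0∞} (hH : Measurable H) :
    ∫⁻ z, H z ∂(lateralMeasure T Ω) = ∫⁻ t in Ioo 0 T, ∫⁻ x in frontier Ω, H (t, x)
      ∂(Measure.euclideanHausdorffMeasure (d - 1)) := by
  have := isLocallyFiniteMeasure_hausdorff_frontier hLip
  exact lintegral_prod _ hH.aemeasurable

theorem lintegral_graph_le_lateralMeasure (hLip : HasUniformlyLipschitzBoundary Ω) {T : ℝ}
    {e : EuclideanSpace ℝ (Fin d) ≃ᵃⁱ[ℝ] WithLp 2 (EuclideanSpace ℝ (Fin (d - 1)) × ℝ)}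
    {f : EuclideanSpace ℝ (Fin (d - 1)) → ℝ} {L : NNReal} (hf : LipschitzWith L f)
    {U : Set (EuclideanSpace ℝ (Fin d))} (hU : IsOpen U)
    (hΩU : U ∩ Ω = U ∩ {x | f (e x).fst < (e x).snd})
    {H : ℝ × EuclideanSpace ℝ (Fin d) → ℝ} (hH : Continuous H)
    (hHU : ∀ t, ∀ x ∉ U, H (t, x) = 0) :
    ∫⁻ t in Ioo 0 T, ∫⁻ y, ‖H (t, coordPoint e y (f y))‖ₑ
      ≤ ∫⁻ z, ‖H z‖ₑ ∂(lateralMeasure T Ω) := by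
  rw [lintegral_lateralMeasure hLip T hH.enorm.measurable]
  refine lintegral_mono fun t => ?_
  have hHt : Measurable fun x => ‖H (t, x)‖ₑ :=
    (hH.comp (Continuous.prodMk_right t)).enorm.measurable
  have hγ := (lipschitzWith_coordPoint_graph (e := e) hf).continuous.measurable
  have hF : MeasurableSet (frontier Ω) := isClosed_frontier.measurableSet
  calc ∫⁻ y, ‖H (t, coordPoint e y (f y))‖ₑ
      = ∫⁻ y, (frontier Ω).indicator (fun x => ‖H (t, x)‖ₑ) (coordPoint e y (f y)) := by
        refine lintegral_congr fun y => ?_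
        by_cases hy : coordPoint e y (f y) ∈ U
        · rw [indicator_of_mem (coordPoint_graph_mem_frontier hU hΩU hy)]
        · simp [hHU t _ hy, indicator]
    _ = ∫⁻ x, (frontier Ω).indicator (fun x => ‖H (t, x)‖ₑ) x
          ∂(Measure.map (fun y => coordPoint e y (f y)) volume) :=
        (lintegral_map (hHt.indicator hF) hγ).symm
    _ ≤ ∫⁻ x, (frontier Ω).indicator (fun x => ‖H (t, x)‖ₑ) x
          ∂(Measure.euclideanHausdorffMeasure (d - 1)) :=
        lintegral_mono' (map_coordPoint_graph_le hf) le_rfl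
    _ = _ := lintegral_indicator hF _

/-- The estimate in one chart is summed using cutoffs `θ n`. The uniform radius `ε` places each
point of a thin layer well inside some chart, and the overlap bound `M` keeps the constant
independent of `φ`, `T` and `δ`. -/
theorem exists_lintegral_thickening_frontier_le (hΩ : IsOpen Ω)
    (hLip : HasUniformlyLipschitzBoundary Ω) :
    ∃ C : NNReal, ∀ (T : ℝ) (φ : ℝ × EuclideanSpace ℝ (Fin d) → ℝ), Continuous φ →
      HasCompactSupport φ → ∀ η : ℝ≥0∞, η ≠ 0 → ∃ δ₀ > 0, ∀ δ, 0 < δ → δ < δ₀ →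
        ∫⁻ z in Ioo 0 T ×ˢ (Ω ∩ thickening δ (frontier Ω)), ‖φ z‖ₑ ≤
          ENNReal.ofReal δ * (C * ∫⁻ z, ‖φ z‖ₑ ∂(lateralMeasure T Ω) + η) := by
  obtain ⟨ε, L, M, U, hε, hL, hUo, hUf, hcov, hball, hM, hchart⟩ := id hLip
  choose e f hf hΩU using hchart
  -- A point within `ε / 2` of `x₀ ∈ ∂Ω` lies in `V n` as soon as `ball x₀ ε ⊆ U n`; there `θ n =
  -- 1`, so `H n` agrees with `φ`.
  set V : ℕ → Set (EuclideanSpace ℝ (Fin d)) := fun n => {x | ball x (ε / 2) ⊆ U n} with hV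
  have hVc : ∀ n, IsClosed (V n) := by
    intro n
    refine isClosed_of_closure_subset fun x hx y hy => ?_
    obtain ⟨r, hr, hyr⟩ : ∃ r > 0, dist y x + r < ε / 2 :=
      ⟨(ε / 2 - dist y x) / 2, by linarith [mem_ball.1 hy], by linarith [mem_ball.1 hy]⟩
    obtain ⟨x', hx', hxx⟩ := Metric.mem_closure_iff.1 hx r hr
    exact hx' (mem_ball.2 (by linarith [dist_triangle y x x']))
  have hVU : ∀ n, V n ⊆ U n := fun n x hx => hx (mem_ball_self (by positivity))
  choose θ hθ0 hθ1 hθ using fun n => exists_continuous_zero_one_of_isClosed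
    (hUo n).isClosed_compl (hVc n) (disjoint_compl_left_iff_subset.2 (hVU n))
  refine ⟨(1 + L) * M, fun T φ hφ hφc η hη => ?_⟩
  set K : Set (EuclideanSpace ℝ (Fin d)) := Prod.snd '' tsupport φ with hK
  have hKc : IsCompact K := hφc.isCompact.image continuous_snd
  -- By local finiteness only these charts meet the support of `φ`, so finitely many error terms
  -- have to be absorbed in `η`.
  set N : Finset ℕ := (hUf.finite_nonempty_inter_compact hKc).toFinset with hN
  obtain ⟨η', hη', hηη⟩ := ENNReal.exists_nnreal_pos_mul_lt
    (a := ((1 + L) * N.card : NNReal)) ENNReal.coe_ne_top hη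
  set H : ℕ → ℝ × EuclideanSpace ℝ (Fin d) → ℝ := fun n z => φ z * θ n z.2 with hH
  have hHc : ∀ n, Continuous (H n) := fun n => hφ.mul ((θ n).continuous.comp continuous_snd)
  have hHs : ∀ n, HasCompactSupport (H n) := fun n => hφc.mul_right
  have hHU : ∀ n t, ∀ x ∉ U n, H n (t, x) = 0 := by
    intro n t x hx
    simp only [hH]
    rw [hθ0 n hx]
    simp
  choose D hD0 hD using fun n => exists_lintegral_graphLayer_le (e := e n) (hf n) (T := T)
    (hHc n) (hHs n) (η := η') (by simpa using hη'.ne')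
  have hL1 : (0 : ℝ) < 1 + L := by positivity
  obtain ⟨δ₁, hδ₁, hδD⟩ : ∃ δ₁ > 0, ∀ n ∈ N, δ₁ ≤ D n := by
    rcases N.eq_empty_or_nonempty with h | h
    · exact ⟨1, one_pos, by simp [h]⟩
    · exact ⟨N.inf' h D, (Finset.lt_inf'_iff h).2 fun n _ => hD0 n, fun n hn => N.inf'_le D hn⟩
  refine ⟨min (ε / 2) (δ₁ / (1 + L)), by positivity, fun δ hδ hδδ => ?_⟩
  have hδε : δ < ε / 2 := hδδ.trans_le (min_le_left _ _)
  have hδL : (1 + L) * δ < δ₁ := by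
    have := hδδ.trans_le (min_le_right _ _)
    rw [lt_div_iff₀ hL1] at this
    linarith
  have hpt : ∀ t x, x ∈ Ω ∩ thickening δ (frontier Ω) → ‖φ (t, x)‖ₑ ≤
      ∑ n ∈ N, (graphLayer (e n) (f n) ((1 + L) * δ)).indicator (fun x => ‖H n (t, x)‖ₑ) x := by
    rintro t x ⟨hxΩ, hxt⟩
    by_cases hφx : φ (t, x) = 0
    · simp [hφx]
    obtain ⟨x₀, hx₀, hxx⟩ := mem_thickening_iff.1 hxt
    obtain ⟨n, hn⟩ := hball x₀ hx₀
    have hxV : x ∈ V n := fun y hy => hn (mem_ball.2 (by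
      linarith [dist_triangle y x x₀, mem_ball.1 hy]))
    have hxU := hVU n hxV
    have hx₀U : x₀ ∈ U n := hn (mem_ball_self hε)
    have hnN : n ∈ N := by
      rw [hN, Set.Finite.mem_toFinset]
      exact ⟨x, hxU, (t, x), subset_tsupport _ hφx, rfl⟩
    -- Moving by `δ` from a frontier point changes the height by at most `δ` and the graph below by
    -- at most `L δ`.
    have hxl : x ∈ graphLayer (e n) (f n) ((1 + L) * δ) := by
      have h1 : x ∈ U n ∩ {x | f n ((e n) x).fst < ((e n) x).snd} := by
        rw [← hΩU n]
        exact ⟨hxU, hxΩ⟩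
      refine ⟨h1.2, ?_⟩
      have h2 := snd_eq_of_mem_frontier (hUo n) (hf n).continuous (hΩU n) hx₀U hx₀
      have h3 := (abs_le.1 ((Real.dist_eq _ _).symm.le.trans (dist_snd_apply_le (e n) x x₀))).2
      have h4 := (hf n).dist_le_mul ((e n) x).fst ((e n) x₀).fst
      have h5 := (abs_le.1 ((Real.dist_eq _ _).symm.le.trans h4)).1
      have h6 := dist_fst_apply_le (e n) x x₀
      have h7 : (L : ℝ) * dist ((e n) x).fst ((e n) x₀).fst ≤ L * δ := by
        gcongr
        linarith
      linarith
    refine le_trans ?_ (Finset.single_le_sum (f := fun n =>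
      (graphLayer (e n) (f n) ((1 + L) * δ)).indicator (fun x => ‖H n (t, x)‖ₑ) x)
      (fun _ _ => zero_le) hnN)
    rw [indicator_of_mem hxl]
    simp only [hH]
    rw [hθ1 n hxV]
    simp
  have hsum : ∀ z, ∑ n ∈ N, ‖H n z‖ₑ ≤ M * ‖φ z‖ₑ := by
    classical
    intro z
    have h1 : ∀ n ∈ N, ‖H n z‖ₑ ≤ ({n | z.2 ∈ U n}).indicator (fun _ => ‖φ z‖ₑ) n := by
      intro n _
      by_cases hn : z.2 ∈ U n
      · rw [indicator_of_mem (by exact hn)]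
        simp only [hH, enorm_mul]
        refine mul_le_of_le_one_right' ?_
        rw [Real.enorm_eq_ofReal (hθ n _).1]
        exact ENNReal.ofReal_le_one.2 (hθ n _).2
      · rw [hHU n z.1 z.2 hn]
        simp
    have hcard : (N.filter fun n => z.2 ∈ U n).card ≤ M := by
      have h2 : (((N.filter fun n => z.2 ∈ U n) : Finset ℕ) : Set ℕ).encard ≤ M :=
        (Set.encard_le_encard (by intro n; simp)).trans (hM z.2)
      rw [Set.encard_coe_eq_coe_finsetCard] at h2
      exact_mod_cast h2
    calc ∑ n ∈ N, ‖H n z‖ₑ ≤ ∑ n ∈ N, ({n | z.2 ∈ U n}).indicator (fun _ => ‖φ z‖ₑ) n :=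
          Finset.sum_le_sum h1
      _ = (N.filter fun n => z.2 ∈ U n).card * ‖φ z‖ₑ := by
          rw [Finset.sum_indicator_eq_sum_filter]
          simp
      _ ≤ _ := by gcongr
  have hmeasH : ∀ n t, Measurable ((graphLayer (e n) (f n) ((1 + L) * δ)).indicator
      (fun x => ‖H n (t, x)‖ₑ)) := fun n t =>
    ((hHc n).comp (Continuous.prodMk_right t)).enorm.measurable.indicator
      (measurableSet_graphLayer (hf n).continuous _)
  have hmeas2 : ∀ n, Measurable fun t => ∫⁻ x in graphLayer (e n) (f n) ((1 + L) * δ),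
      ‖H n (t, x)‖ₑ := fun n => (hHc n).enorm.measurable.lintegral_prod_right'
  have hA : MeasurableSet (Ω ∩ thickening δ (frontier Ω)) :=
    (hΩ.inter isOpen_thickening).measurableSet
  calc ∫⁻ z in Ioo 0 T ×ˢ (Ω ∩ thickening δ (frontier Ω)), ‖φ z‖ₑ
      = ∫⁻ t in Ioo 0 T, ∫⁻ x in Ω ∩ thickening δ (frontier Ω), ‖φ (t, x)‖ₑ := by
        rw [Measure.volume_eq_prod, ← Measure.prod_restrict]
        exact lintegral_prod _ hφ.enorm.measurable.aemeasurable
    _ ≤ ∫⁻ t in Ioo 0 T, ∑ n ∈ N, ∫⁻ x in graphLayer (e n) (f n) ((1 + L) * δ),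
          ‖H n (t, x)‖ₑ := by
        refine lintegral_mono fun t => ?_
        simp only
        simp_rw [← lintegral_indicator (measurableSet_graphLayer (hf _).continuous _)]
        rw [← lintegral_finsetSum _ fun n _ => hmeasH n t]
        exact (setLIntegral_mono' hA fun x hx => hpt t x hx).trans (setLIntegral_le_lintegral _ _)
    _ = ∑ n ∈ N, ∫⁻ t in Ioo 0 T, ∫⁻ x in graphLayer (e n) (f n) ((1 + L) * δ),
          ‖H n (t, x)‖ₑ := lintegral_finsetSum _ fun n _ => hmeas2 n
    _ ≤ ∑ n ∈ N, ENNReal.ofReal ((1 + L) * δ) *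
          ((∫⁻ z, ‖H n z‖ₑ ∂(lateralMeasure T Ω)) + η') := by
        refine Finset.sum_le_sum fun n hn => (hD n _ (by positivity)
          (hδL.trans_le (hδD n hn))).trans ?_
        gcongr
        exact lintegral_graph_le_lateralMeasure hLip (hf n) (hUo n) (hΩU n) (hHc n) (hHU n)
    _ = ENNReal.ofReal ((1 + L) * δ) *
          ((∫⁻ z, ∑ n ∈ N, ‖H n z‖ₑ ∂(lateralMeasure T Ω)) + N.card * η') := by
        rw [← Finset.mul_sum, Finset.sum_add_distrib,
          lintegral_finsetSum _ fun n _ => (hHc n).enorm.measurable]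
        simp
    _ ≤ ENNReal.ofReal ((1 + L) * δ) *
          ((∫⁻ z, M * ‖φ z‖ₑ ∂(lateralMeasure T Ω)) + N.card * η') := by
        gcongr with z
        exact hsum z
    _ = ENNReal.ofReal δ * (((1 + L) * M : NNReal) * ∫⁻ z, ‖φ z‖ₑ ∂(lateralMeasure T Ω)
          + η' * ((1 + L) * N.card : NNReal)) := by
        rw [lintegral_const_mul _ hφ.enorm.measurable, ENNReal.ofReal_mul hL1.le]
        have : ENNReal.ofReal (1 + L) = (1 + L : NNReal) := by
          rw [← ENNReal.ofReal_coe_nnreal]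
          simp
        rw [this]
        push_cast
        ring
    _ ≤ _ := by gcongr

end Layer

/-! ### Smooth cutoffs adapted to the initial face and to `∂Ω`. -/

section Cutoff

variable {d : ℕ} {Ω : Set (EuclideanSpace ℝ (Fin d))}

/-- Averaging against a probability density supported in a ball of radius `δ` preserves the
Lipschitz constant and moves values by at most `δ`. -/
theorem exists_contDiff_lipschitzWith_one_approx {G : EuclideanSpace ℝ (Fin d) → ℝ}
    (hG : LipschitzWith 1 G) {δ : ℝ} (hδ : 0 < δ) :
    ∃ g : EuclideanSpace ℝ (Fin d) → ℝ, ContDiff ℝ (⊤ : ℕ∞) g ∧ LipschitzWith 1 g ∧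
      ∀ x, |g x - G x| ≤ δ := by
  let ρ : ContDiffBump (0 : EuclideanSpace ℝ (Fin d)) := ⟨δ / 2, δ, by positivity, by linarith⟩
  have hint : ∀ x, Integrable (fun t => ρ.normed volume t * G (x - t)) := fun x =>
    (ρ.continuous_normed.mul (hG.continuous.comp (continuous_sub_left x))).integrable_of_hasCompactSupport
      ρ.hasCompactSupport_normed.mul_right
  refine ⟨convolution (ρ.normed volume) G (ContinuousLinearMap.lsmul ℝ ℝ) volume, ?_, ?_, ?_⟩
  · exact ρ.hasCompactSupport_normed.contDiff_convolution_left _ ρ.contDiff_normed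
      hG.continuous.locallyIntegrable
  · refine LipschitzWith.of_dist_le_mul fun x x' => ?_
    rw [convolution_def, convolution_def, NNReal.coe_one, one_mul, dist_eq_norm]
    simp only [ContinuousLinearMap.lsmul_apply, smul_eq_mul]
    rw [← integral_sub (hint x) (hint x')]
    have h1 : ∫ t, ρ.normed volume t * dist x x' = dist x x' := by
      rw [integral_mul_const, ρ.integral_normed, one_mul]
    rw [← h1]
    refine norm_integral_le_of_norm_le (ρ.integrable_normed.mul_const _)
      (Filter.Eventually.of_forall fun t => ?_)
    rw [← mul_sub, norm_mul, Real.norm_of_nonneg (ρ.nonneg_normed t), ← dist_eq_norm]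
    refine mul_le_mul_of_nonneg_left ?_ (ρ.nonneg_normed t)
    have := hG.dist_le_mul (x - t) (x' - t)
    simpa using this
  · intro x
    rw [← Real.dist_eq]
    refine ρ.dist_normed_convolution_le hG.continuous.aestronglyMeasurable fun y hy => ?_
    have := hG.dist_le_mul y x
    simp only [NNReal.coe_one, one_mul] at this
    exact this.trans (mem_ball.1 hy).le

/-- `g` is the distance to the complement, smoothed up to an error `δ / 2`: `g ≥ δ` forces positive
distance, and `g ≤ 2δ` forces distance at most `5δ/2 < 3δ`. -/
theorem exists_contDiff_approx_dist_frontier {δ : ℝ} (hδ : 0 < δ) :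
    ∃ g : EuclideanSpace ℝ (Fin d) → ℝ, ContDiff ℝ (⊤ : ℕ∞) g ∧ LipschitzWith 1 g ∧
      (∀ x, δ ≤ g x → x ∈ Ω) ∧ ∀ x ∈ Ω, g x ≤ 2 * δ → x ∈ thickening (3 * δ) (frontier Ω) := by
  -- The distance to the empty set is 0 by convention, so the whole space is treated apart, with a
  -- constant exceeding `2δ`.
  by_cases hu : Ω = univ
  · refine ⟨fun _ => 3 * δ, contDiff_const, LipschitzWith.const' _, by simp [hu], ?_⟩
    intro x _ h
    linarith
  obtain ⟨g, hg, hgL, hgG⟩ := exists_contDiff_lipschitzWith_one_approx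
    (G := fun x => infDist x Ωᶜ) (lipschitz_infDist_pt _) (half_pos hδ)
  refine ⟨g, hg, hgL, fun x hx => ?_, fun x hxΩ hx => ?_⟩
  · by_contra h
    have h1 := (abs_le.1 (hgG x)).2
    rw [infDist_zero_of_mem h] at h1
    linarith
  · obtain ⟨y, hy, hxy⟩ := exists_mem_frontier_infDist_compl_eq_dist hxΩ hu
    have h1 := (abs_le.1 (hgG x)).1
    refine mem_thickening_iff.2 ⟨y, hy, ?_⟩
    linarith

theorem exists_abs_deriv_smoothTransition_le :
    ∃ A : ℝ, 0 ≤ A ∧ ∀ s, |deriv Real.smoothTransition s| ≤ A := by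
  have hc : Continuous (deriv Real.smoothTransition) :=
    (Real.smoothTransition.contDiff (n := 1)).continuous_deriv le_rfl
  obtain ⟨A, hA⟩ := (isCompact_Icc (a := (0 : ℝ)) (b := 1)).exists_bound_of_continuousOn
    hc.continuousOn
  refine ⟨max A 0, le_max_right _ _, fun s => ?_⟩
  by_cases hs : s ∈ Icc (0 : ℝ) 1
  · exact (hA s hs).trans (le_max_left _ _)
  · have : deriv Real.smoothTransition s = 0 := by
      rcases lt_or_ge s 0 with h | h
      · have : Real.smoothTransition =ᶠ[nhds s] fun _ => 0 := by
          filter_upwards [Iio_mem_nhds h] with r hr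
          exact Real.smoothTransition.zero_of_nonpos (le_of_lt hr)
        rw [this.deriv_eq, deriv_const]
      · have h1 : 1 < s := by
          by_contra h2
          exact hs ⟨h, not_lt.1 h2⟩
        have : Real.smoothTransition =ᶠ[nhds s] fun _ => 1 := by
          filter_upwards [Ioi_mem_nhds h1] with r hr
          exact Real.smoothTransition.one_of_one_le (le_of_lt hr)
        rw [this.deriv_eq, deriv_const]
    rw [this, abs_zero]
    exact le_max_right _ _

/-- The cutoff is `a(t) a(g(x))` with a ramp `a` from 0 to 1 on `[δ, 2δ]`. The two terms of the
derivative bound keep time and space components apart, so a flux without time component sees no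
initial layer. Nothing is cut near `t = T`, where the test functions vanish. -/
theorem exists_cutoff (Ω : Set (EuclideanSpace ℝ (Fin d))) :
    ∃ A : ℝ, 0 ≤ A ∧ ∀ δ > 0, ∃ κ : ℝ × EuclideanSpace ℝ (Fin d) → ℝ,
      ContDiff ℝ (⊤ : ℕ∞) κ ∧ (∀ z, κ z ∈ Icc (0 : ℝ) 1) ∧ tsupport κ ⊆ Ici δ ×ˢ Ω ∧
      (∀ t, ∀ x ∈ Ω, 2 * δ < t → x ∉ thickening (3 * δ) (frontier Ω) → κ (t, x) = 1) ∧
      ∀ t, ∀ x ∈ Ω, ∀ s v, |fderiv ℝ κ (t, x) (s, v)| ≤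
        A / δ * (Iic (2 * δ)).indicator (fun _ => |s|) t
          + A / δ * (thickening (3 * δ) (frontier Ω)).indicator (fun _ => ‖v‖) x := by
  obtain ⟨A, hA0, hA⟩ := exists_abs_deriv_smoothTransition_le
  refine ⟨A, hA0, fun δ hδ => ?_⟩
  obtain ⟨g, hg, hgL, hg1, hg2⟩ := exists_contDiff_approx_dist_frontier (Ω := Ω) hδ
  set a : ℝ → ℝ := fun t => Real.smoothTransition (t / δ - 1) with ha
  have haC : ContDiff ℝ (⊤ : ℕ∞) a :=
    Real.smoothTransition.contDiff.comp ((contDiff_id.div_const δ).sub contDiff_const)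
  have haI : ∀ t, a t ∈ Icc (0 : ℝ) 1 := fun t =>
    ⟨Real.smoothTransition.nonneg _, Real.smoothTransition.le_one _⟩
  have ha0 : ∀ t, t ≤ δ → a t = 0 := fun t ht =>
    Real.smoothTransition.zero_of_nonpos (by rw [sub_nonpos]; exact div_le_one_of_le₀ ht hδ.le)
  have ha1 : ∀ t, 2 * δ ≤ t → a t = 1 := fun t ht =>
    Real.smoothTransition.one_of_one_le (by
      rw [le_sub_iff_add_le, le_div_iff₀ hδ]
      linarith)
  have hda : ∀ t, |deriv a t| ≤ A / δ := by
    intro t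
    have h1 : HasDerivAt (fun t : ℝ => t / δ - 1) (1 / δ) t :=
      ((hasDerivAt_id t).div_const δ).sub_const 1
    have h2 : HasDerivAt a (deriv Real.smoothTransition (t / δ - 1) * (1 / δ)) t :=
      HasDerivAt.comp (h₂ := Real.smoothTransition) (h := fun t : ℝ => t / δ - 1) t
        ((Real.smoothTransition.contDiff (n := 1)).differentiable one_ne_zero
          (t / δ - 1)).hasDerivAt h1
    rw [h2.deriv, abs_mul, abs_of_pos (one_div_pos.2 hδ), mul_one_div]
    gcongr
    exact hA _
  have hda1 : ∀ t, 2 * δ < t → deriv a t = 0 := by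
    intro t ht
    have : a =ᶠ[nhds t] fun _ => 1 := by
      filter_upwards [Ioi_mem_nhds ht] with r hr
      exact ha1 r (le_of_lt hr)
    rw [this.deriv_eq, deriv_const]
  have hdag : ∀ x v, |fderiv ℝ (fun x => a (g x)) x v| ≤ A / δ * ‖v‖ := by
    intro x v
    have hgd : DifferentiableAt ℝ g x := hg.differentiable (by simp) x
    have had : DifferentiableAt ℝ a (g x) := haC.differentiable (by simp) _
    have h1 : HasFDerivAt (fun x => a (g x)) (deriv a (g x) • fderiv ℝ g x) x :=
      had.hasDerivAt.comp_hasFDerivAt x hgd.hasFDerivAt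
    rw [h1.fderiv, smul_apply, smul_eq_mul, abs_mul]
    have h2 := (fderiv ℝ g x).le_of_opNorm_le (norm_fderiv_le_of_lipschitz ℝ hgL) v
    rw [NNReal.coe_one, one_mul, Real.norm_eq_abs] at h2
    gcongr
    exact hda _
  have hdag1 : ∀ x, 2 * δ < g x → fderiv ℝ (fun x => a (g x)) x = 0 := by
    intro x hx
    have : (fun x => a (g x)) =ᶠ[nhds x] fun _ => 1 := by
      filter_upwards [hg.continuous.continuousAt.eventually (Ioi_mem_nhds hx)] with r hr
      exact ha1 _ (le_of_lt hr)
    rw [this.fderiv_eq, fderiv_fun_const, Pi.zero_apply]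
  have hagC : ContDiff ℝ (⊤ : ℕ∞) fun x => a (g x) := haC.comp hg
  refine ⟨fun z => a z.1 * a (g z.2), (haC.comp contDiff_fst).mul (hagC.comp contDiff_snd),
    fun z => ⟨mul_nonneg (haI _).1 (haI _).1, mul_le_one₀ (haI _).2 (haI _).1 (haI _).2⟩,
    ?_, fun t x hx ht hxt => ?_, fun t x hx s v => ?_⟩
  · have hcl : IsClosed {z : ℝ × EuclideanSpace ℝ (Fin d) | δ ≤ z.1 ∧ δ ≤ g z.2} :=
      (isClosed_le continuous_const continuous_fst).inter
        (isClosed_le continuous_const (hg.continuous.comp continuous_snd))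
    refine (closure_minimal (fun z hz => ?_) hcl).trans fun z hz => ⟨hz.1, hg1 _ hz.2⟩
    constructor
    · by_contra h
      exact hz (by simp only [ha0 _ (not_le.1 h).le, zero_mul])
    · by_contra h
      exact hz (by simp only [ha0 _ (not_le.1 h).le, mul_zero])
  · have : 2 * δ ≤ g x := by
      by_contra h
      exact hxt (hg2 x hx (not_le.1 h).le)
    simp only [ha1 t ht.le, ha1 _ this, one_mul]
  · have h1 : HasFDerivAt (fun z : ℝ × EuclideanSpace ℝ (Fin d) => a z.1)
        (deriv a t • ContinuousLinearMap.fst ℝ ℝ (EuclideanSpace ℝ (Fin d))) (t, x) :=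
      HasDerivAt.comp_hasFDerivAt (h₂ := a)
        (f := (Prod.fst : ℝ × EuclideanSpace ℝ (Fin d) → ℝ)) (t, x)
        (haC.differentiable (by simp) t).hasDerivAt hasFDerivAt_fst
    have h2 : HasFDerivAt (fun z : ℝ × EuclideanSpace ℝ (Fin d) => a (g z.2))
        ((fderiv ℝ (fun x => a (g x)) x).comp
          (ContinuousLinearMap.snd ℝ ℝ (EuclideanSpace ℝ (Fin d)))) (t, x) :=
      HasFDerivAt.comp (g := fun x => a (g x))
        (f := (Prod.snd : ℝ × EuclideanSpace ℝ (Fin d) → EuclideanSpace ℝ (Fin d))) (t, x)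
        (hagC.differentiable (by simp) x).hasFDerivAt hasFDerivAt_snd
    have h3 := (h1.mul h2).fderiv
    simp only at h3
    rw [show (fun z : ℝ × EuclideanSpace ℝ (Fin d) => a z.1 * a (g z.2))
      = (fun z => a z.1) * fun z => a (g z.2) from rfl, h3]
    simp only [add_apply, smul_apply,
      ContinuousLinearMap.comp_apply, ContinuousLinearMap.coe_fst', ContinuousLinearMap.coe_snd',
      smul_eq_mul]
    have e1 : |deriv a t * s| ≤ A / δ * (Iic (2 * δ)).indicator (fun _ => |s|) t := by
      by_cases ht : t ≤ 2 * δ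
      · rw [indicator_of_mem (by exact ht), abs_mul]
        gcongr
        exact hda t
      · rw [hda1 t (not_le.1 ht), indicator_of_notMem (by exact ht)]
        simp
    have e2 : |fderiv ℝ (fun x => a (g x)) x v| ≤
        A / δ * (thickening (3 * δ) (frontier Ω)).indicator (fun _ => ‖v‖) x := by
      by_cases hxt : x ∈ thickening (3 * δ) (frontier Ω)
      · rw [indicator_of_mem hxt]
        exact hdag x v
      · rw [hdag1 x (by
          by_contra h
          exact hxt (hg2 x hx (not_lt.1 h))), indicator_of_notMem hxt]
        simp
    have hab : ∀ t, |a t| ≤ 1 := fun t => abs_le.2 ⟨by linarith [(haI t).1], (haI t).2⟩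
    calc |a t * fderiv ℝ (fun x => a (g x)) x v + a (g x) * (deriv a t * s)|
        ≤ |a t * fderiv ℝ (fun x => a (g x)) x v| + |a (g x) * (deriv a t * s)| := abs_add_le _ _
      _ ≤ |fderiv ℝ (fun x => a (g x)) x v| + |deriv a t * s| := by
          rw [abs_mul, abs_mul (a (g x))]
          gcongr
          · exact mul_le_of_le_one_left (abs_nonneg _) (hab _)
          · exact mul_le_of_le_one_left (abs_nonneg _) (hab _)
      _ ≤ _ := by linarith

end Cutoff

/-! ### The a priori bound of the weak form by boundary integrals. -/

section Bound

variable {d : ℕ} {Ω : Set (EuclideanSpace ℝ (Fin d))} {T : ℝ}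

theorem exists_lintegral_initialLayer_le (Ω : Set (EuclideanSpace ℝ (Fin d)))
    {φ : ℝ × EuclideanSpace ℝ (Fin d) → ℝ} (hφ : Continuous φ) (hφc : HasCompactSupport φ)
    {η : ℝ≥0∞} (hη : η ≠ 0) :
    ∃ δ₀ > 0, ∀ δ, 0 < δ → δ < δ₀ → ∫⁻ z in Ioc 0 δ ×ˢ Ω, ‖φ z‖ₑ ≤
      ENNReal.ofReal δ * ((∫⁻ x in Ω, ‖φ (0, x)‖ₑ) + η) := by
  set K : Set (EuclideanSpace ℝ (Fin d)) := Prod.snd '' tsupport φ with hK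
  have hKc : IsCompact K := hφc.isCompact.image continuous_snd
  obtain ⟨ω, hω, hωη⟩ := ENNReal.exists_nnreal_pos_mul_lt (hKc.measure_lt_top (μ := volume)).ne hη
  obtain ⟨δ₀, hδ₀, hUC⟩ := Metric.uniformContinuous_iff.1
    (hφc.uniformContinuous_of_continuous hφ) ω (by exact_mod_cast hω)
  refine ⟨δ₀, hδ₀, fun δ hδ hδδ => ?_⟩
  have key : ∀ t x, t ∈ Ioc 0 δ →
      ‖φ (t, x)‖ₑ ≤ ‖φ (0, x)‖ₑ + K.indicator (fun _ => (ω : ℝ≥0∞)) x := by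
    intro t x ht
    by_cases hx : x ∈ K
    · rw [indicator_of_mem hx]
      have h1 : dist (t, x) (0, x) < δ₀ := by
        rw [dist_prod_same_right, Real.dist_eq, sub_zero, abs_of_pos ht.1]
        linarith [ht.2]
      have h2 := hUC h1
      have h3 : ‖φ (t, x) - φ (0, x)‖ₑ ≤ (ω : ℝ≥0∞) := by
        rw [enorm_eq_nnnorm]
        rw [dist_eq_norm] at h2
        exact_mod_cast h2.le
      calc ‖φ (t, x)‖ₑ = ‖φ (0, x) + (φ (t, x) - φ (0, x))‖ₑ := by congr 1; ring
        _ ≤ _ := (enorm_add_le _ _).trans (by gcongr)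
    · have : φ (t, x) = 0 := by
        by_contra h
        exact hx ⟨(t, x), subset_tsupport _ h, rfl⟩
      rw [this]
      simp
  have hm : Measurable fun x => ‖φ (0, x)‖ₑ :=
    (hφ.comp (Continuous.prodMk_right 0)).enorm.measurable
  calc ∫⁻ z in Ioc 0 δ ×ˢ Ω, ‖φ z‖ₑ = ∫⁻ t in Ioc 0 δ, ∫⁻ x in Ω, ‖φ (t, x)‖ₑ := by
        rw [Measure.volume_eq_prod, ← Measure.prod_restrict]
        exact lintegral_prod _ hφ.enorm.measurable.aemeasurable
    _ ≤ ∫⁻ t in Ioc 0 δ, ((∫⁻ x in Ω, ‖φ (0, x)‖ₑ) + η) := by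
        refine setLIntegral_mono' measurableSet_Ioc fun t ht => ?_
        refine (lintegral_mono fun x => key t x ht).trans ?_
        rw [lintegral_add_left hm]
        gcongr
        refine (setLIntegral_le_lintegral _ _).trans ?_
        rw [lintegral_indicator hKc.measurableSet, setLIntegral_const]
        exact hωη.le
    _ = _ := by
        rw [setLIntegral_const, Real.volume_Ioc, sub_zero, mul_comm]

theorem exists_ae_enorm_le_of_memLp_top {α F : Type*} [MeasurableSpace α] [NormedAddCommGroup F]
    {μ : Measure α} {g : α → F} (hg : MemLp g ∞ μ) : ∃ C : NNReal, ∀ᵐ z ∂μ, ‖g z‖ₑ ≤ C := by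
  refine ⟨(eLpNorm g ∞ μ).toNNReal, ?_⟩
  rw [ENNReal.coe_toNNReal hg.2.ne, eLpNorm_exponent_top]
  exact enorm_ae_le_eLpNormEssSup g μ

theorem exists_ae_norm_le_of_memLp_top {α F : Type*} [MeasurableSpace α] [NormedAddCommGroup F]
    {μ : Measure α} {g : α → F} (hg : MemLp g ∞ μ) : ∃ C : ℝ, ∀ᵐ z ∂μ, ‖g z‖ ≤ C := by
  obtain ⟨C, hC⟩ := exists_ae_enorm_le_of_memLp_top hg
  refine ⟨C, ?_⟩
  filter_upwards [hC] with z hz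
  rw [enorm_eq_nnnorm] at hz
  exact_mod_cast hz

theorem measurableSet_spaceTimeCylinder (hΩ : IsOpen Ω) :
    MeasurableSet (spaceTimeCylinder T Ω) :=
  measurableSet_Ioo.prod hΩ.measurableSet

theorem IsTestFunctionUpToZero.integrable {φ : ℝ × EuclideanSpace ℝ (Fin d) → ℝ}
    (hφ : IsTestFunctionUpToZero T φ) (μ : Measure (ℝ × EuclideanSpace ℝ (Fin d)))
    [IsLocallyFiniteMeasure μ] : Integrable φ μ :=
  hφ.1.continuous.integrable_of_hasCompactSupport hφ.2.1

/-- The part of the support with `t ≥ 0` over `closure Ω` is compact and misses `t = T`, so local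
finiteness up to the boundary applies to it. -/
theorem IsTestFunctionUpToZero.integrableOn {φ : ℝ × EuclideanSpace ℝ (Fin d) → ℝ}
    (hφ : IsTestFunctionUpToZero T φ) {μ : Measure (ℝ × EuclideanSpace ℝ (Fin d))}
    (hμ : LocallyFiniteUpToBoundary T Ω μ) (hΩ : IsOpen Ω) :
    IntegrableOn φ (spaceTimeCylinder T Ω) μ := by
  set K : Set (ℝ × EuclideanSpace ℝ (Fin d)) := tsupport φ ∩ (Ici 0 ×ˢ closure Ω) with hK
  have hKc : IsCompact K := hφ.2.1.isCompact.inter_right (isClosed_Ici.prod isClosed_closure)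
  have hμK := hμ K hKc fun z hz => ⟨⟨hz.2.1, (hφ.2.2 hz.1).1⟩, hz.2.2⟩
  have h1 : IntegrableOn φ K (μ.restrict (spaceTimeCylinder T Ω)) := by
    obtain ⟨A, hA⟩ := hφ.2.1.exists_bound_of_continuous hφ.1.continuous
    exact IntegrableOn.of_bound hμK hφ.1.continuous.aestronglyMeasurable A
      (Filter.Eventually.of_forall hA)
  refine ((integrable_indicator_iff hKc.measurableSet).2 h1).congr ?_
  · filter_upwards [ae_restrict_mem (measurableSet_spaceTimeCylinder hΩ)] with z hz
    by_cases h : z ∈ K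
    · rw [indicator_of_mem h]
    · rw [indicator_of_notMem h]
      by_contra h2
      exact h ⟨subset_tsupport _ (Ne.symm h2), hz.1.1.le, subset_closure hz.2⟩

/-- The weak form, tested with `φ`, of the flux `B` (with a time and a space component), the
bounded source `f` and the source measure `μp - μn` on `]0, T[ × Ω`. -/
noncomputable def fluxPairing (T : ℝ) (Ω : Set (EuclideanSpace ℝ (Fin d)))
    (B : ℝ × EuclideanSpace ℝ (Fin d) → ℝ × EuclideanSpace ℝ (Fin d))
    (f : ℝ × EuclideanSpace ℝ (Fin d) → ℝ) (μp μn : Measure (ℝ × EuclideanSpace ℝ (Fin d)))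
    (φ : ℝ × EuclideanSpace ℝ (Fin d) → ℝ) : ℝ :=
  (∫ z in spaceTimeCylinder T Ω, fderiv ℝ φ z (B z)) + (∫ z in spaceTimeCylinder T Ω, f z * φ z)
    + ((∫ z in spaceTimeCylinder T Ω, φ z ∂μp) - ∫ z in spaceTimeCylinder T Ω, φ z ∂μn)

theorem integrable_fderiv_apply {φ : ℝ × EuclideanSpace ℝ (Fin d) → ℝ}
    (hφ : ContDiff ℝ (⊤ : ℕ∞) φ) (hφc : HasCompactSupport φ)
    {B : ℝ × EuclideanSpace ℝ (Fin d) → ℝ × EuclideanSpace ℝ (Fin d)}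
    {μ : Measure (ℝ × EuclideanSpace ℝ (Fin d))} [IsLocallyFiniteMeasure μ]
    (hB : MemLp B ∞ μ) : Integrable (fun z => fderiv ℝ φ z (B z)) μ := by
  have hc : Continuous (fderiv ℝ φ) := hφ.continuous_fderiv (by simp)
  have hi : Integrable (fderiv ℝ φ) μ := hc.integrable_of_hasCompactSupport (hφc.fderiv ℝ)
  obtain ⟨A, hA⟩ := exists_ae_norm_le_of_memLp_top hB
  refine (hi.norm.mul_const A).mono'
    (isBoundedBilinearMap_apply.continuous.comp_aestronglyMeasurable (hi.1.prodMk hB.1)) ?_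
  filter_upwards [hA] with z hz
  exact (ContinuousLinearMap.le_opNorm _ _).trans (by gcongr)

theorem tendsto_integral_cutoff_mul (hΩ : IsOpen Ω)
    {κ : ℕ → ℝ × EuclideanSpace ℝ (Fin d) → ℝ}
    (hκ : ∀ n, Continuous (κ n)) (hκI : ∀ n z, κ n z ∈ Icc (0 : ℝ) 1)
    (hκ1 : ∀ z ∈ spaceTimeCylinder T Ω, ∀ᶠ n in Filter.atTop, κ n z = 1)
    {μ : Measure (ℝ × EuclideanSpace ℝ (Fin d))} {F : ℝ × EuclideanSpace ℝ (Fin d) → ℝ}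
    (hF : IntegrableOn F (spaceTimeCylinder T Ω) μ) :
    Filter.Tendsto (fun n => ∫ z in spaceTimeCylinder T Ω, κ n z * F z ∂μ) Filter.atTop
      (nhds (∫ z in spaceTimeCylinder T Ω, F z ∂μ)) := by
  refine tendsto_integral_of_dominated_convergence (fun z => ‖F z‖)
    (fun n => (hκ n).aestronglyMeasurable.mul hF.1) hF.norm
    (fun n => Filter.Eventually.of_forall fun z => ?_) ?_
  · rw [norm_mul, Real.norm_of_nonneg (hκI n z).1]
    exact mul_le_of_le_one_left (norm_nonneg _) (hκI n z).2
  · filter_upwards [ae_restrict_mem (measurableSet_spaceTimeCylinder hΩ)] with z hz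
    refine tendsto_const_nhds.congr' ?_
    filter_upwards [hκ1 z hz] with n hn
    rw [hn, one_mul]

theorem enorm_integral_mul_fderiv_cutoff_le (hΩ : IsOpen Ω)
    {B : ℝ × EuclideanSpace ℝ (Fin d) → ℝ × EuclideanSpace ℝ (Fin d)} {Cw Cc : NNReal}
    (hBw : ∀ᵐ z ∂(volume.restrict (spaceTimeCylinder T Ω)), ‖(B z).1‖ₑ ≤ Cw)
    (hBc : ∀ᵐ z ∂(volume.restrict (spaceTimeCylinder T Ω)), ‖(B z).2‖ₑ ≤ Cc)
    {φ κ : ℝ × EuclideanSpace ℝ (Fin d) → ℝ} (hφ : Continuous φ) {A δ : ℝ} (hA : 0 ≤ A)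
    (hδ : 0 < δ)
    (hκ : ∀ t, ∀ x ∈ Ω, ∀ s v, |fderiv ℝ κ (t, x) (s, v)| ≤
        A / δ * (Iic (2 * δ)).indicator (fun _ => |s|) t
          + A / δ * (thickening (3 * δ) (frontier Ω)).indicator (fun _ => ‖v‖) x) :
    ‖∫ z in spaceTimeCylinder T Ω, φ z * fderiv ℝ κ z (B z)‖ₑ ≤
      ENNReal.ofReal (A / δ) * (Cw * (∫⁻ z in Ioc 0 (2 * δ) ×ˢ Ω, ‖φ z‖ₑ)
        + Cc * ∫⁻ z in Ioo 0 T ×ˢ (Ω ∩ thickening (3 * δ) (frontier Ω)), ‖φ z‖ₑ) := by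
  have hQ := measurableSet_spaceTimeCylinder (T := T) hΩ
  have hAδ : 0 ≤ A / δ := by positivity
  have hS1 : MeasurableSet (Ioc 0 (2 * δ) ×ˢ Ω) := measurableSet_Ioc.prod hΩ.measurableSet
  have hS2 : MeasurableSet (Ioo 0 T ×ˢ (Ω ∩ thickening (3 * δ) (frontier Ω))) :=
    measurableSet_Ioo.prod (hΩ.inter isOpen_thickening).measurableSet
  have hm := hφ.enorm.measurable
  refine (enorm_integral_le_lintegral_enorm _).trans ?_
  calc ∫⁻ z in spaceTimeCylinder T Ω, ‖φ z * fderiv ℝ κ z (B z)‖ₑ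
      ≤ ∫⁻ z in spaceTimeCylinder T Ω, ENNReal.ofReal (A / δ) *
          (Cw * (Ioc 0 (2 * δ) ×ˢ Ω).indicator (fun z => ‖φ z‖ₑ) z
          + Cc * (Ioo 0 T ×ˢ (Ω ∩ thickening (3 * δ) (frontier Ω))).indicator
              (fun z => ‖φ z‖ₑ) z) := by
        refine lintegral_mono_ae ?_
        filter_upwards [hBw, hBc, ae_restrict_mem hQ] with z h1 h2 hz
        have h3 := hκ z.1 z.2 hz.2 (B z).1 (B z).2
        have h4 : ‖fderiv ℝ κ z (B z)‖ₑ ≤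
            ENNReal.ofReal (A / δ) * (Ioc 0 (2 * δ) ×ˢ Ω).indicator (fun _ => (Cw : ℝ≥0∞)) z
            + ENNReal.ofReal (A / δ) * (Ioo 0 T ×ˢ (Ω ∩ thickening (3 * δ) (frontier Ω))).indicator
              (fun _ => (Cc : ℝ≥0∞)) z := by
          rw [Real.enorm_eq_ofReal_abs]
          refine (ENNReal.ofReal_le_ofReal h3).trans (ENNReal.ofReal_add_le.trans ?_)
          rw [ENNReal.ofReal_mul hAδ, ENNReal.ofReal_mul hAδ]
          gcongr
          · by_cases ht : z.1 ∈ Iic (2 * δ)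
            · rw [indicator_of_mem ht, indicator_of_mem (by exact ⟨⟨hz.1.1, ht⟩, hz.2⟩),
                ← Real.enorm_eq_ofReal_abs]
              exact h1
            · rw [indicator_of_notMem ht]
              simp
          · by_cases hx : z.2 ∈ thickening (3 * δ) (frontier Ω)
            · rw [indicator_of_mem hx, indicator_of_mem (by exact ⟨hz.1, hz.2, hx⟩),
                ofReal_norm]
              exact h2
            · rw [indicator_of_notMem hx]
              simp
        rw [enorm_mul]
        refine (mul_le_mul_right h4 _).trans_eq ?_
        by_cases c1 : z ∈ Ioc 0 (2 * δ) ×ˢ Ω <;>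
        by_cases c2 : z ∈ Ioo 0 T ×ˢ (Ω ∩ thickening (3 * δ) (frontier Ω)) <;>
        simp only [indicator_of_mem, indicator_of_notMem, c1, c2, not_false_eq_true] <;> ring
    _ ≤ ∫⁻ z, ENNReal.ofReal (A / δ) *
          (Cw * (Ioc 0 (2 * δ) ×ˢ Ω).indicator (fun z => ‖φ z‖ₑ) z
          + Cc * (Ioo 0 T ×ˢ (Ω ∩ thickening (3 * δ) (frontier Ω))).indicator
              (fun z => ‖φ z‖ₑ) z) := setLIntegral_le_lintegral _ _
    _ = _ := by
        rw [lintegral_const_mul' _ _ ENNReal.ofReal_ne_top,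
          lintegral_add_left ((hm.indicator hS1).const_mul _),
          lintegral_const_mul' _ _ ENNReal.coe_ne_top, lintegral_const_mul' _ _ ENNReal.coe_ne_top,
          lintegral_indicator hS1, lintegral_indicator hS2]

/-- The central estimate: the `1/δ` of the cutoff derivative cancels the width of the layers. Only
the sup bounds of the two flux components enter; the sources disappear in the limit. -/
theorem exists_enorm_fluxPairing_le (hΩ : IsOpen Ω) (hLip : HasUniformlyLipschitzBoundary Ω) :
    ∃ C : NNReal, ∀ (B : ℝ × EuclideanSpace ℝ (Fin d) → ℝ × EuclideanSpace ℝ (Fin d))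
      (f : ℝ × EuclideanSpace ℝ (Fin d) → ℝ) (μp μn : Measure (ℝ × EuclideanSpace ℝ (Fin d)))
      (Cw Cc : NNReal), MemLp B ∞ (volume.restrict (spaceTimeCylinder T Ω)) →
      MemLp f ∞ (volume.restrict (spaceTimeCylinder T Ω)) →
      (∀ᵐ z ∂(volume.restrict (spaceTimeCylinder T Ω)), ‖(B z).1‖ₑ ≤ Cw) →
      (∀ᵐ z ∂(volume.restrict (spaceTimeCylinder T Ω)), ‖(B z).2‖ₑ ≤ Cc) →
      LocallyFiniteUpToBoundary T Ω μp → LocallyFiniteUpToBoundary T Ω μn →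
      (∀ η, IsTestFunction (spaceTimeCylinder T Ω) η → fluxPairing T Ω B f μp μn η = 0) →
      ∀ φ, IsTestFunctionUpToZero T φ → ‖fluxPairing T Ω B f μp μn φ‖ₑ ≤
        C * (Cw * (∫⁻ x in Ω, ‖φ (0, x)‖ₑ) + Cc * ∫⁻ z, ‖φ z‖ₑ ∂(lateralMeasure T Ω)) := by
  obtain ⟨C', hC'⟩ := exists_lintegral_thickening_frontier_le hΩ hLip
  obtain ⟨A, hA, hcut⟩ := exists_cutoff Ω
  -- The factors 2 and 3 are the widths `2δ` and `3δ` of the initial and lateral layers.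
  refine ⟨A.toNNReal * 2 + A.toNNReal * 3 * C',
    fun B f μp μn Cw Cc hB hf hBw hBc hμp hμn hzero φ hφ => ?_⟩
  set Q := spaceTimeCylinder T Ω with hQdef
  have hQm : MeasurableSet Q := measurableSet_spaceTimeCylinder hΩ
  set δ : ℕ → ℝ := fun n => 1 / ((n : ℝ) + 1) with hδdef
  have hδ : ∀ n, 0 < δ n := fun n => by positivity
  have hδ0 : Filter.Tendsto δ Filter.atTop (nhds 0) := tendsto_one_div_add_atTop_nhds_zero_nat
  have hδev : ∀ r > 0, ∀ᶠ n in Filter.atTop, δ n < r := fun r hr =>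
    hδ0.eventually (Iio_mem_nhds hr)
  choose κ hκC hκI hκs hκ1 hκd using fun n => hcut (δ n) (hδ n)
  have hφC := hφ.1
  have hφc := hφ.2.1
  have hκ1' : ∀ z ∈ Q, ∀ᶠ n in Filter.atTop, κ n z = 1 := by
    rintro ⟨t, x⟩ ⟨ht, hx⟩
    have hxF : x ∈ (frontier Ω)ᶜ := fun h => by
      rw [hΩ.frontier_eq] at h
      exact h.2 hx
    obtain ⟨r, hr, hrF⟩ := Metric.isOpen_iff.1 isClosed_frontier.isOpen_compl x hxF
    filter_upwards [hδev (t / 2) (half_pos ht.1), hδev (r / 3) (by positivity)] with n h1 h2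
    refine hκ1 n t x hx (by linarith) fun h => ?_
    obtain ⟨y, hy, hxy⟩ := mem_thickening_iff.1 h
    exact hrF (mem_ball.2 (by rw [dist_comm]; linarith)) hy
  -- The factor `κ n` keeps the support away from `t = 0` and `∂Ω`, and `φ` keeps it away from `t =
  -- T`.
  have htest : ∀ n, IsTestFunction Q fun z => κ n z * φ z := by
    intro n
    refine ⟨(hκC n).mul hφC, hφc.mul_left, fun z hz => ?_⟩
    have h1 := hκs n (tsupport_mul_subset_left hz)
    have h2 := hφ.2.2 (tsupport_mul_subset_right hz)
    exact ⟨⟨(hδ n).trans_le h1.1, h2.1⟩, h1.2⟩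
  have hi1 : IntegrableOn (fun z => fderiv ℝ φ z (B z)) Q :=
    integrable_fderiv_apply hφC hφc hB
  have hi2 : IntegrableOn (fun z => f z * φ z) Q := by
    obtain ⟨D, hD⟩ := exists_ae_norm_le_of_memLp_top hf
    exact (hφ.integrable _).bdd_mul hf.1 hD
  have hi3 := hφ.integrableOn hμp hΩ
  have hi4 := hφ.integrableOn hμn hΩ
  have hlim := (((tendsto_integral_cutoff_mul hΩ (fun n => (hκC n).continuous) hκI hκ1' hi1).add
    (tendsto_integral_cutoff_mul hΩ (fun n => (hκC n).continuous) hκI hκ1' hi2))).add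
    ((tendsto_integral_cutoff_mul hΩ (fun n => (hκC n).continuous) hκI hκ1' hi3).sub
    (tendsto_integral_cutoff_mul hΩ (fun n => (hκC n).continuous) hκI hκ1' hi4))
  have hfd : ∀ n z, fderiv ℝ (fun z => κ n z * φ z) z (B z)
      = κ n z * fderiv ℝ φ z (B z) + φ z * fderiv ℝ (κ n) z (B z) := by
    intro n z
    rw [fderiv_fun_mul ((hκC n).differentiable (by simp) z) (hφC.differentiable (by simp) z)]
    simp
  have hi5 : ∀ n, IntegrableOn (fun z => κ n z * fderiv ℝ φ z (B z)) Q := by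
    intro n
    exact hi1.bdd_mul (c := 1) (hκC n).continuous.aestronglyMeasurable
      (Filter.Eventually.of_forall fun z => by
        rw [Real.norm_of_nonneg (hκI n z).1]
        exact (hκI n z).2)
  have hi6 : ∀ n, IntegrableOn (fun z => φ z * fderiv ℝ (κ n) z (B z)) Q := by
    intro n
    refine ((integrable_fderiv_apply (htest n).1 (htest n).2.1 hB).sub (hi5 n)).congr
      (Filter.Eventually.of_forall fun z => ?_)
    simp only [Pi.sub_apply]
    rw [hfd]
    ring
  -- The pairing of `κ n * φ` vanishes; the product rule isolates the derivative of the cutoff.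
  have heq : ∀ n, (∫ z in Q, κ n z * fderiv ℝ φ z (B z)) + (∫ z in Q, κ n z * (f z * φ z))
      + ((∫ z in Q, κ n z * φ z ∂μp) - ∫ z in Q, κ n z * φ z ∂μn)
      = - ∫ z in Q, φ z * fderiv ℝ (κ n) z (B z) := by
    intro n
    have h := hzero _ (htest n)
    unfold fluxPairing at h
    simp_rw [hfd] at h
    rw [integral_add (hi5 n) (hi6 n)] at h
    have h2 : ∫ z in Q, f z * (κ n z * φ z) = ∫ z in Q, κ n z * (f z * φ z) :=
      integral_congr_ae (Filter.Eventually.of_forall fun z => by ring)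
    rw [h2] at h
    linarith
  replace hlim := hlim.congr heq
  have hlim2 : Filter.Tendsto (fun n => ‖- ∫ z in Q, φ z * fderiv ℝ (κ n) z (B z)‖ₑ) Filter.atTop
      (nhds ‖fluxPairing T Ω B f μp μn φ‖ₑ) := (continuous_enorm.tendsto _).comp hlim
  set I0 := ∫⁻ x in Ω, ‖φ (0, x)‖ₑ with hI0
  set I1 := ∫⁻ z, ‖φ z‖ₑ ∂(lateralMeasure T Ω) with hI1
  -- Here `n → ∞` is taken with the layer error `η` fixed; `η` is sent to 0 afterwards.
  have hη : ∀ η : NNReal, 0 < η → ‖fluxPairing T Ω B f μp μn φ‖ₑ ≤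
      A.toNNReal * 2 * Cw * (I0 + η) + A.toNNReal * 3 * Cc * (C' * I1 + η) := by
    intro η hη
    have hη' : (η : ℝ≥0∞) ≠ 0 := by exact_mod_cast hη.ne'
    obtain ⟨r0, hr0, h0⟩ := exists_lintegral_initialLayer_le Ω hφC.continuous hφc hη'
    obtain ⟨r1, hr1, h1⟩ := hC' T φ hφC.continuous hφc η hη'
    refine le_of_tendsto hlim2 ?_
    filter_upwards [hδev (r0 / 2) (by positivity), hδev (r1 / 3) (by positivity)] with n hn0 hn1
    rw [enorm_neg]
    refine (enorm_integral_mul_fderiv_cutoff_le hΩ hBw hBc hφC.continuous hA (hδ n)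
      (hκd n)).trans ?_
    have e0 := h0 (2 * δ n) (by linarith [hδ n]) (by linarith)
    have e1 := h1 (3 * δ n) (by linarith [hδ n]) (by linarith)
    have hAδ : ENNReal.ofReal (A / δ n) * ENNReal.ofReal (δ n) = A.toNNReal := by
      rw [← ENNReal.ofReal_mul (by have := hδ n; positivity), div_mul_cancel₀ _ (hδ n).ne']
      rfl
    rw [ENNReal.ofReal_mul (by norm_num)] at e0 e1
    calc ENNReal.ofReal (A / δ n) * (Cw * (∫⁻ z in Ioc 0 (2 * δ n) ×ˢ Ω, ‖φ z‖ₑ)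
          + Cc * ∫⁻ z in Ioo 0 T ×ˢ (Ω ∩ thickening (3 * δ n) (frontier Ω)), ‖φ z‖ₑ)
        ≤ ENNReal.ofReal (A / δ n) *
          (Cw * (ENNReal.ofReal 2 * ENNReal.ofReal (δ n) * (I0 + η))
          + Cc * (ENNReal.ofReal 3 * ENNReal.ofReal (δ n) * (C' * I1 + η))) := by gcongr
      _ = (ENNReal.ofReal (A / δ n) * ENNReal.ofReal (δ n)) * 2 * Cw * (I0 + η)
          + (ENNReal.ofReal (A / δ n) * ENNReal.ofReal (δ n)) * 3 * Cc * (C' * I1 + η) := by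
          rw [show ENNReal.ofReal 2 = 2 by simp, show ENNReal.ofReal 3 = 3 by simp]
          ring
      _ = _ := by rw [hAδ]
  have hle : ‖fluxPairing T Ω B f μp μn φ‖ₑ ≤
      A.toNNReal * 2 * Cw * I0 + A.toNNReal * 3 * Cc * (C' * I1) := by
    refine ENNReal.le_of_forall_pos_le_add fun ε hε _ => ?_
    obtain ⟨η, hη0, hηε⟩ := ENNReal.exists_nnreal_pos_mul_lt
      (a := ((A.toNNReal * 2 * Cw + A.toNNReal * 3 * Cc : NNReal) : ℝ≥0∞)) (b := ε)
      ENNReal.coe_ne_top (by exact_mod_cast hε.ne')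
    calc _ ≤ _ := hη η hη0
      _ = A.toNNReal * 2 * Cw * I0 + A.toNNReal * 3 * Cc * (C' * I1)
          + η * ((A.toNNReal * 2 * Cw + A.toNNReal * 3 * Cc : NNReal) : ℝ≥0∞) := by
        push_cast
        ring
      _ ≤ _ := by gcongr
  refine hle.trans ?_
  push_cast
  rw [mul_add]
  gcongr ?_ + ?_
  · rw [mul_assoc (_ * 2)]
    gcongr
    exact le_self_add
  · calc (A.toNNReal : ℝ≥0∞) * 3 * Cc * (C' * I1) = A.toNNReal * 3 * C' * (Cc * I1) := by ring
      _ ≤ _ := by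
        gcongr
        exact le_add_self

end Bound

/-! ### Existence and uniqueness of the traces. -/

section Trace

variable {d : ℕ} {Ω : Set (EuclideanSpace ℝ (Fin d))} {T : ℝ}

theorem integrable_memLp_top_mul {μ : Measure (ℝ × EuclideanSpace ℝ (Fin d))}
    {g φ : ℝ × EuclideanSpace ℝ (Fin d) → ℝ} (hg : MemLp g ∞ μ) (hφ : Integrable φ μ) :
    Integrable (fun z => g z * φ z) μ := by
  obtain ⟨C, hC⟩ := exists_ae_norm_le_of_memLp_top hg
  exact hφ.bdd_mul hg.1 hC

/-- The space `C_c^∞([0, T[ × ℝᵈ)`. -/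
def testFunctionsUpToZero (d : ℕ) (T : ℝ) :
    Submodule ℝ (ℝ × EuclideanSpace ℝ (Fin d) → ℝ) where
  carrier := {φ | IsTestFunctionUpToZero T φ}
  zero_mem' := ⟨contDiff_const, HasCompactSupport.zero, by simp⟩
  add_mem' := fun {φ ψ} hφ hψ => ⟨hφ.1.add hψ.1, hφ.2.1.add hψ.2.1,
    (tsupport_add φ ψ).trans (union_subset hφ.2.2 hψ.2.2)⟩
  smul_mem' := fun c φ hφ => ⟨contDiff_const.smul hφ.1, hφ.2.1.smul_left,
    (closure_mono (Function.support_const_smul_subset c φ)).trans hφ.2.2⟩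

/-- The duality lemma applied to test functions mapped into `L¹(ν)`. The hypotheses on `B`, `f` and
the measures serve to make the pairing additive. -/
theorem exists_memLp_top_fluxPairing_eq (hΩ : IsOpen Ω)
    {B : ℝ × EuclideanSpace ℝ (Fin d) → ℝ × EuclideanSpace ℝ (Fin d)}
    {f : ℝ × EuclideanSpace ℝ (Fin d) → ℝ} {μp μn : Measure (ℝ × EuclideanSpace ℝ (Fin d))}
    (hB : MemLp B ∞ (volume.restrict (spaceTimeCylinder T Ω)))
    (hf : MemLp f ∞ (volume.restrict (spaceTimeCylinder T Ω)))
    (hμp : LocallyFiniteUpToBoundary T Ω μp) (hμn : LocallyFiniteUpToBoundary T Ω μn)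
    (ν : Measure (ℝ × EuclideanSpace ℝ (Fin d))) [IsLocallyFiniteMeasure ν] (C : NNReal)
    (hC : ∀ φ, IsTestFunctionUpToZero T φ →
      ‖fluxPairing T Ω B f μp μn φ‖ₑ ≤ C * ∫⁻ z, ‖φ z‖ₑ ∂ν) :
    ∃ G : ℝ × EuclideanSpace ℝ (Fin d) → ℝ, MemLp G ∞ ν ∧ ∀ φ, IsTestFunctionUpToZero T φ →
      fluxPairing T Ω B f μp μn φ = ∫ z, G z * φ z ∂ν := by
  let ι : testFunctionsUpToZero d T →ₗ[ℝ] Lp ℝ 1 ν :=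
    { toFun := fun φ => (IsTestFunctionUpToZero.integrable φ.2 ν).toL1 _
      map_add' := fun φ ψ => Integrable.toL1_add _ _ _ _
      map_smul' := fun c φ => Integrable.toL1_smul (φ : ℝ × EuclideanSpace ℝ (Fin d) → ℝ)
        (IsTestFunctionUpToZero.integrable φ.2 ν) c }
  let Λ : testFunctionsUpToZero d T →ₗ[ℝ] ℝ :=
    { toFun := fun φ => fluxPairing T Ω B f μp μn φ
      map_add' := fun φ ψ => by
        have hφ := φ.2
        have hψ := ψ.2
        have h1 : ∀ z, fderiv ℝ ((φ + ψ : testFunctionsUpToZero d T) :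
            ℝ × EuclideanSpace ℝ (Fin d) → ℝ) z (B z)
            = fderiv ℝ φ z (B z) + fderiv ℝ ψ z (B z) := by
          intro z
          rw [Submodule.coe_add, fderiv_add (hφ.1.differentiable (by simp) z)
            (hψ.1.differentiable (by simp) z)]
          rfl
        simp only [fluxPairing, h1]
        simp only [Submodule.coe_add, Pi.add_apply, mul_add]
        rw [integral_add (integrable_fderiv_apply hφ.1 hφ.2.1 hB)
            (integrable_fderiv_apply hψ.1 hψ.2.1 hB),
          integral_add (integrable_memLp_top_mul hf (IsTestFunctionUpToZero.integrable hφ _))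
            (integrable_memLp_top_mul hf (IsTestFunctionUpToZero.integrable hψ _)),
          integral_add (IsTestFunctionUpToZero.integrableOn hφ hμp hΩ)
            (IsTestFunctionUpToZero.integrableOn hψ hμp hΩ),
          integral_add (IsTestFunctionUpToZero.integrableOn hφ hμn hΩ)
            (IsTestFunctionUpToZero.integrableOn hψ hμn hΩ)]
        ring
      map_smul' := fun c φ => by
        have hφ := φ.2
        have h1 : ∀ z, fderiv ℝ ((c • φ : testFunctionsUpToZero d T) :
            ℝ × EuclideanSpace ℝ (Fin d) → ℝ) z (B z) = c * fderiv ℝ φ z (B z) := by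
          intro z
          rw [Submodule.coe_smul, fderiv_const_smul (hφ.1.differentiable (by simp) z)]
          rfl
        simp only [fluxPairing, h1]
        simp only [Submodule.coe_smul, Pi.smul_apply, smul_eq_mul, mul_left_comm _ c,
          integral_const_mul, RingHom.id_apply]
        ring }
  obtain ⟨G, hG, hrep⟩ := exists_memLp_top_repr_of_le ν ι Λ C fun φ => by
    have h := hC φ φ.2
    have hi := IsTestFunctionUpToZero.integrable φ.2 ν
    have h1 : ‖ι φ‖ₑ = ∫⁻ z, ‖(φ : ℝ × EuclideanSpace ℝ (Fin d) → ℝ) z‖ₑ ∂ν :=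
      Integrable.enorm_toL1 hi
    rw [← h1] at h
    have h2 : ‖Λ φ‖ₑ ≤ C * ‖ι φ‖ₑ := h
    simp only [enorm_eq_nnnorm] at h2
    exact_mod_cast h2
  refine ⟨G, hG, fun φ hφ => ?_⟩
  refine (hrep ⟨φ, hφ⟩).trans (integral_congr_ae ?_)
  filter_upwards [(hφ.integrable ν).coeFn_toL1] with z hz
  exact congrArg (G z * ·) hz

/-- Fundamental theorem of calculus on each time line, with `φ` zero at `t = T`. -/
theorem setIntegral_timeDeriv (hT : 0 < T) {φ : ℝ × EuclideanSpace ℝ (Fin d) → ℝ}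
    (hφ : IsTestFunctionUpToZero T φ) (Ω : Set (EuclideanSpace ℝ (Fin d))) :
    ∫ z in spaceTimeCylinder T Ω, timeDeriv φ z = - ∫ x in Ω, φ (0, x) := by
  have hi : Integrable (fun z => timeDeriv φ z)
      (volume.restrict (spaceTimeCylinder T Ω)) := by
    have hc : Continuous (fun z => timeDeriv φ z) :=
      (hφ.1.continuous_fderiv (by simp)).clm_apply continuous_const
    exact hc.integrable_of_hasCompactSupport (hφ.2.1.fderiv_apply ℝ (1, 0))
  have hr : (volume.restrict (spaceTimeCylinder T Ω) : Measure (ℝ × EuclideanSpace ℝ (Fin d)))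
      = (volume.restrict (Ioo 0 T)).prod (volume.restrict Ω) := by
    rw [Measure.prod_restrict]
    rfl
  rw [hr] at hi ⊢
  rw [integral_prod_symm _ hi, ← integral_neg]
  refine integral_congr_ae (Filter.Eventually.of_forall fun x => ?_)
  simp only
  have hd : ∀ t, HasDerivAt (fun t => φ (t, x)) (timeDeriv φ (t, x)) t := by
    intro t
    have h1 := (hφ.1.differentiable (by simp) (t, x)).hasFDerivAt
    have h2 : HasDerivAt (fun t : ℝ => (t, x)) ((1 : ℝ), (0 : EuclideanSpace ℝ (Fin d))) t :=
      (hasDerivAt_id t).prodMk (hasDerivAt_const t x)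
    exact h1.comp_hasDerivAt t h2
  have hc : Continuous (fun t => timeDeriv φ (t, x)) :=
    ((hφ.1.continuous_fderiv (by simp)).clm_apply continuous_const).comp
      (Continuous.prodMk_left x)
  rw [← integral_Ioc_eq_integral_Ioo, ← intervalIntegral.integral_of_le hT.le,
    intervalIntegral.integral_eq_sub_of_hasDerivAt (fun t _ => hd t) (hc.intervalIntegrable _ _)]
  have : φ (T, x) = 0 := by
    by_contra h
    exact lt_irrefl T (hφ.2.2 (subset_tsupport _ h)).1
  rw [this, zero_sub]

/-- Test functions supported in `]0,T[ × ℝᵈ` do not see the initial term and determine `u`, the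
lateral measure being carried by this open set. With `u = 0` known, products `a(t) g(x)` with `a(0)
= 1` isolate `v`. -/
theorem ae_eq_zero_of_forall_trace_eq_zero (hLip : HasUniformlyLipschitzBoundary Ω) (hT : 0 < T)
    {u : ℝ × EuclideanSpace ℝ (Fin d) → ℝ} {v : EuclideanSpace ℝ (Fin d) → ℝ}
    (hu : MemLp u ∞ (lateralMeasure T Ω)) (hv : MemLp v ∞ (volume.restrict Ω))
    (h : ∀ φ, IsTestFunctionUpToZero T φ →
      (∫ z, u z * φ z ∂(lateralMeasure T Ω)) - ∫ x in Ω, φ (0, x) * v x = 0) :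
    (∀ᵐ z ∂(lateralMeasure T Ω), u z = 0) ∧ ∀ᵐ x ∂(volume.restrict Ω), v x = 0 := by
  have := isLocallyFiniteMeasure_lateralMeasure hLip T
  have := isLocallyFiniteMeasure_hausdorff_frontier hLip
  have hU : IsOpen (Ioo 0 T ×ˢ (univ : Set (EuclideanSpace ℝ (Fin d)))) :=
    isOpen_Ioo.prod isOpen_univ
  have hu0 : ∀ᵐ z ∂(lateralMeasure T Ω), u z = 0 := by
    have hmem : ∀ᵐ z ∂(lateralMeasure T Ω),
        z ∈ Ioo 0 T ×ˢ (univ : Set (EuclideanSpace ℝ (Fin d))) := by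
      have h1 : {z : ℝ × EuclideanSpace ℝ (Fin d) | z ∉ Ioo 0 T ×ˢ univ} = (Ioo 0 T)ᶜ ×ˢ univ := by
        ext z
        simp
      rw [ae_iff, h1, lateralMeasure, Measure.prod_prod,
        Measure.restrict_apply measurableSet_Ioo.compl, compl_inter_self, measure_empty, zero_mul]
    have h2 := hU.ae_eq_zero_of_integral_contDiff_smul_eq_zero
      ((hu.locallyIntegrable le_top).locallyIntegrableOn _) fun g hg hgc hgU => by
        have h3 := h g ⟨hg, hgc, fun z hz => ⟨(hgU hz).1.2, mem_univ _⟩⟩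
        have h4 : ∀ x, g (0, x) = 0 := fun x => by
          by_contra h
          exact lt_irrefl 0 (hgU (subset_tsupport _ h)).1.1
        simp only [h4, zero_mul, integral_zero, sub_zero] at h3
        simpa only [smul_eq_mul, mul_comm] using h3
    filter_upwards [hmem, h2] with z h3 h4 using h4 h3
  refine ⟨hu0, ?_⟩
  refine ae_eq_zero_of_integral_contDiff_smul_eq_zero (hv.locallyIntegrable le_top)
    fun g hg hgc => ?_
  -- The outer radius `T / 2` keeps the support in `t < T`.
  let a : ContDiffBump (0 : ℝ) := ⟨T / 4, T / 2, by positivity, by linarith⟩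
  have hsub : (Function.support fun z : ℝ × EuclideanSpace ℝ (Fin d) => a z.1 * g z.2)
      ⊆ tsupport a ×ˢ tsupport g := fun z hz =>
    ⟨subset_tsupport _ (left_ne_zero_of_mul hz), subset_tsupport _ (right_ne_zero_of_mul hz)⟩
  have hts : (tsupport fun z : ℝ × EuclideanSpace ℝ (Fin d) => a z.1 * g z.2)
      ⊆ tsupport a ×ˢ tsupport g :=
    closure_minimal hsub ((isClosed_tsupport _).prod (isClosed_tsupport _))
  have h3 := h (fun z => a z.1 * g z.2) ⟨(a.contDiff.comp contDiff_fst).mul (hg.comp contDiff_snd),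
    HasCompactSupport.of_support_subset_isCompact (a.hasCompactSupport.isCompact.prod hgc.isCompact)
      hsub, fun z hz => ⟨?_, mem_univ _⟩⟩
  · have h4 : ∫ z, u z * (a z.1 * g z.2) ∂(lateralMeasure T Ω) = 0 := by
      refine integral_eq_zero_of_ae ?_
      filter_upwards [hu0] with z hz
      rw [hz, zero_mul, Pi.zero_apply]
    have h5 : a 0 = 1 := a.one_of_mem_closedBall (mem_closedBall_self (by positivity))
    rw [h4, zero_sub, neg_eq_zero] at h3
    simpa only [h5, one_mul, smul_eq_mul] using h3
  · have h6 := (hts hz).1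
    rw [a.tsupport_eq, mem_closedBall, Real.dist_eq, sub_zero] at h6
    have h7 : z.1 ≤ T / 2 := (le_abs_self _).trans h6
    rw [mem_Iio]
    linarith

theorem memLp_prodMk_of_memLp {M : Type*} {E F : Type*} [NormedAddCommGroup E]
    [NormedAddCommGroup F] [MeasurableSpace M] {μ : Measure M} {g : M → E} {h : M → F}
    (hg : MemLp g ∞ μ) (hh : MemLp h ∞ μ) : MemLp (fun z => (g z, h z)) ∞ μ := by
  obtain ⟨C, hC⟩ := exists_ae_norm_le_of_memLp_top hg
  obtain ⟨D, hD⟩ := exists_ae_norm_le_of_memLp_top hh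
  refine memLp_top_of_bound (hg.1.prodMk hh.1) (max C D) ?_
  filter_upwards [hC, hD] with z h1 h2
  exact max_le_max h1 h2

theorem locallyFiniteUpToBoundary_zero :
    LocallyFiniteUpToBoundary T Ω (0 : Measure (ℝ × EuclideanSpace ℝ (Fin d))) :=
  fun K _ _ => by simp

/-- The flux is `(0, b)`: its time component has bound 0, so the pairing is dominated by the lateral
measure alone. -/
theorem existsUnique_normalTrace (hΩ : IsOpen Ω) (hLip : HasUniformlyLipschitzBoundary Ω)
    (hT : 0 < T) {b : ℝ × EuclideanSpace ℝ (Fin d) → EuclideanSpace ℝ (Fin d)}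
    (hb : MemLp b ∞ (volume.restrict (spaceTimeCylinder T Ω)))
    {μp μn : Measure (ℝ × EuclideanSpace ℝ (Fin d))} (hdiv : HasSpaceDivergence T Ω b μp μn)
    (hμp : LocallyFiniteUpToBoundary T Ω μp) (hμn : LocallyFiniteUpToBoundary T Ω μn) :
    ∃! trb : Lp ℝ ∞ (lateralMeasure T Ω), ∀ φ, IsTestFunctionUpToZero T φ →
      (∫ z, trb z * φ z ∂(lateralMeasure T Ω)) - ∫ x in Ω, φ (0, x) =
        (∫ z in spaceTimeCylinder T Ω, (timeDeriv φ z + spaceDeriv φ z (b z)))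
          + ((∫ z in spaceTimeCylinder T Ω, φ z ∂μp)
            - ∫ z in spaceTimeCylinder T Ω, φ z ∂μn) := by
  have := isLocallyFiniteMeasure_lateralMeasure hLip T
  have h0 : MemLp (0 : ℝ × EuclideanSpace ℝ (Fin d) → ℝ) ∞
    (volume.restrict (spaceTimeCylinder T Ω)) := MemLp.zero
  have hB := memLp_prodMk_of_memLp h0 hb
  obtain ⟨Cc, hCc⟩ := exists_ae_enorm_le_of_memLp_top hb
  have hflux : ∀ φ, fluxPairing T Ω (fun z => ((0 : ℝ × EuclideanSpace ℝ (Fin d) → ℝ) z, b z)) 0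
      μp μn φ = (∫ z in spaceTimeCylinder T Ω, spaceDeriv φ z (b z))
        + ((∫ z in spaceTimeCylinder T Ω, φ z ∂μp)
          - ∫ z in spaceTimeCylinder T Ω, φ z ∂μn) := by
    intro φ
    simp [fluxPairing, spaceDeriv]
  obtain ⟨C, hC⟩ := exists_enorm_fluxPairing_le (T := T) hΩ hLip
  have hbd := hC _ 0 μp μn 0 Cc hB h0 (Filter.Eventually.of_forall fun z => by simp) hCc hμp hμn
    fun η hη => by
      rw [hflux, ← hdiv.2.2 η hη]
      ring
  obtain ⟨G, hG, hrep⟩ := exists_memLp_top_fluxPairing_eq hΩ hB h0 hμp hμn (lateralMeasure T Ω)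
    (C * Cc) fun φ hφ => (hbd φ hφ).trans_eq (by push_cast; ring)
  refine ⟨hG.toLp G, fun φ hφ => ?_, fun trb htrb => ?_⟩
  · have h1 : ∫ z, (hG.toLp G : ℝ × EuclideanSpace ℝ (Fin d) → ℝ) z * φ z ∂(lateralMeasure T Ω)
        = ∫ z, G z * φ z ∂(lateralMeasure T Ω) := by
      refine integral_congr_ae ?_
      filter_upwards [hG.coeFn_toLp] with z hz
      rw [hz]
    have h2 : Integrable (fun z => spaceDeriv φ z (b z))
      (volume.restrict (spaceTimeCylinder T Ω)) := integrable_fderiv_apply hφ.1 hφ.2.1 hB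
    have h3 : Integrable (fun z => timeDeriv φ z) (volume.restrict (spaceTimeCylinder T Ω)) :=
      ((hφ.1.continuous_fderiv (by simp)).clm_apply
        continuous_const).integrable_of_hasCompactSupport (hφ.2.1.fderiv_apply ℝ (1, 0))
    rw [h1, ← hrep φ hφ, hflux, integral_add h3 h2, setIntegral_timeDeriv hT hφ]
    ring
  · have h1 := (ae_eq_zero_of_forall_trace_eq_zero hLip hT (v := 0)
      ((Lp.memLp trb).sub hG) MemLp.zero fun φ hφ => by
        have e1 := htrb φ hφ
        have h2 : Integrable (fun z => spaceDeriv φ z (b z))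
          (volume.restrict (spaceTimeCylinder T Ω)) := integrable_fderiv_apply hφ.1 hφ.2.1 hB
        have h3 : Integrable (fun z => timeDeriv φ z)
            (volume.restrict (spaceTimeCylinder T Ω)) :=
          ((hφ.1.continuous_fderiv (by simp)).clm_apply
            continuous_const).integrable_of_hasCompactSupport (hφ.2.1.fderiv_apply ℝ (1, 0))
        have e2 := hrep φ hφ
        rw [hflux] at e2
        rw [integral_add h3 h2, setIntegral_timeDeriv hT hφ] at e1
        simp only [Pi.sub_apply, sub_mul, Pi.zero_apply, mul_zero, integral_zero, sub_zero]
        rw [integral_sub (integrable_memLp_top_mul (Lp.memLp trb) (hφ.integrable _))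
          (integrable_memLp_top_mul hG (hφ.integrable _))]
        linarith).1
    ext1
    filter_upwards [h1, hG.coeFn_toLp] with z h2 h3
    rw [h3]
    exact sub_eq_zero.1 h2

/-- The flux is `(w, w b)`, and one density `G` is found for the lateral measure plus a copy of
Lebesgue measure on `{0} × Ω`. It gives `Tr(bw)` on the lateral boundary and `w₀ = -G(0,·)`, the
sign being that of the initial term. -/
theorem existsUnique_lateral_initial_trace (hΩ : IsOpen Ω)
    (hLip : HasUniformlyLipschitzBoundary Ω)
    (hT : 0 < T) {b : ℝ × EuclideanSpace ℝ (Fin d) → EuclideanSpace ℝ (Fin d)}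
    (hb : MemLp b ∞ (volume.restrict (spaceTimeCylinder T Ω)))
    {w f : ℝ × EuclideanSpace ℝ (Fin d) → ℝ}
    (hw : MemLp w ∞ (volume.restrict (spaceTimeCylinder T Ω)))
    (hf : MemLp f ∞ (volume.restrict (spaceTimeCylinder T Ω)))
    (hsol : IsDistributionalSolution T Ω b w f) :
    ∃! p : Lp ℝ ∞ (lateralMeasure T Ω) × Lp ℝ ∞ (volume.restrict Ω),
      ∀ φ, IsTestFunctionUpToZero T φ →
        (∫ z, p.1 z * φ z ∂(lateralMeasure T Ω)) - ∫ x in Ω, φ (0, x) * p.2 x =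
          (∫ z in spaceTimeCylinder T Ω, w z * (timeDeriv φ z + spaceDeriv φ z (b z)))
            + ∫ z in spaceTimeCylinder T Ω, f z * φ z := by
  have := isLocallyFiniteMeasure_lateralMeasure hLip T
  have hwb : MemLp (fun z => w z • b z) ∞ (volume.restrict (spaceTimeCylinder T Ω)) := hb.smul hw
  have hB := memLp_prodMk_of_memLp hw hwb
  obtain ⟨Cw, hCw⟩ := exists_ae_enorm_le_of_memLp_top hw
  obtain ⟨Cc, hCc⟩ := exists_ae_enorm_le_of_memLp_top hwb
  have hflux : ∀ φ, fluxPairing T Ω (fun z => (w z, w z • b z)) f 0 0 φ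
      = (∫ z in spaceTimeCylinder T Ω, w z * (timeDeriv φ z + spaceDeriv φ z (b z)))
        + ∫ z in spaceTimeCylinder T Ω, f z * φ z := by
    intro φ
    have h1 : ∀ z, fderiv ℝ φ z (w z, w z • b z)
        = w z * (timeDeriv φ z + spaceDeriv φ z (b z)) := by
      intro z
      rw [timeDeriv, spaceDeriv, ← map_add, ← smul_eq_mul, ← map_smul]
      simp
    simp [fluxPairing, h1]
  obtain ⟨C, hC⟩ := exists_enorm_fluxPairing_le (T := T) hΩ hLip
  have hbd := hC _ f 0 0 Cw Cc hB hf hCw hCc locallyFiniteUpToBoundary_zero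
    locallyFiniteUpToBoundary_zero fun η hη => by rw [hflux, hsol η hη]
  have hmk : Measurable (Prod.mk (0 : ℝ) : EuclideanSpace ℝ (Fin d) → _) := measurable_prodMk_left
  set ν₀ : Measure (ℝ × EuclideanSpace ℝ (Fin d)) := (volume.restrict Ω).map (Prod.mk 0) with hν₀
  have hν₀f : IsLocallyFiniteMeasure ν₀ := by
    rw [hν₀, ← Measure.dirac_prod]
    infer_instance
  have hνf : IsLocallyFiniteMeasure (lateralMeasure T Ω + ν₀) := by
    refine ⟨fun z => ?_⟩
    obtain ⟨s, hs, hs'⟩ := (lateralMeasure T Ω).finiteAt_nhds z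
    obtain ⟨t, ht, ht'⟩ := ν₀.finiteAt_nhds z
    refine ⟨s ∩ t, Filter.inter_mem hs ht, ?_⟩
    rw [Measure.add_apply]
    exact ENNReal.add_lt_top.2 ⟨(measure_mono inter_subset_left).trans_lt hs',
      (measure_mono inter_subset_right).trans_lt ht'⟩
  -- Taking the larger of the two sup bounds turns the two-term estimate into a single `L¹` norm for
  -- the sum measure.
  obtain ⟨G, hG, hrep⟩ := exists_memLp_top_fluxPairing_eq hΩ hB hf locallyFiniteUpToBoundary_zero
    locallyFiniteUpToBoundary_zero (lateralMeasure T Ω + ν₀) (C * max Cw Cc) fun φ hφ => by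
      refine (hbd φ hφ).trans ?_
      rw [lintegral_add_measure, hν₀, lintegral_map hφ.1.continuous.enorm.measurable hmk,
        ENNReal.coe_mul, mul_assoc, add_comm (∫⁻ z, _ ∂(lateralMeasure T Ω)), mul_add (_ : ℝ≥0∞)
          (∫⁻ x in Ω, _)]
      gcongr
      · exact le_max_left _ _
      · exact le_max_right _ _
  have hG1 : MemLp G ∞ (lateralMeasure T Ω) := hG.mono_measure (Measure.le_add_right le_rfl)
  have hG0 : MemLp G ∞ ν₀ := hG.mono_measure (Measure.le_add_left le_rfl)
  have hG2 : MemLp (fun x => - G (0, x)) ∞ (volume.restrict Ω) :=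
    ((memLp_map_measure_iff hG0.1 hmk.aemeasurable).1 hG0).neg
  have hval : ∀ φ, IsTestFunctionUpToZero T φ →
      (∫ z, G z * φ z ∂(lateralMeasure T Ω)) - ∫ x in Ω, φ (0, x) * (- G (0, x)) =
        (∫ z in spaceTimeCylinder T Ω, w z * (timeDeriv φ z + spaceDeriv φ z (b z)))
            + ∫ z in spaceTimeCylinder T Ω, f z * φ z := by
    intro φ hφ
    rw [← hflux, hrep φ hφ, integral_add_measure
      (integrable_memLp_top_mul hG1 (hφ.integrable _))
      (integrable_memLp_top_mul hG0 (hφ.integrable _)), hν₀,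
      integral_map (f := fun z => G z * φ z) hmk.aemeasurable (hG0.1.mul hφ.1.continuous.aestronglyMeasurable)]
    simp only [mul_neg, integral_neg, sub_neg_eq_add]
    simp only [mul_comm (φ _)]
  have hφv : ∀ φ, IsTestFunctionUpToZero T φ → ∀ v, MemLp v ∞ (volume.restrict Ω) →
      IntegrableOn (fun x => φ (0, x) * v x) Ω := by
    intro φ hφ v hv
    obtain ⟨D, hD⟩ := exists_ae_norm_le_of_memLp_top hv
    have hi : IntegrableOn (fun x => φ (0, x)) Ω :=
      (integrable_map_measure hφ.1.continuous.aestronglyMeasurable hmk.aemeasurable).1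
        (hφ.integrable ν₀)
    exact hi.mul_bdd hv.1 hD
  refine ⟨(hG1.toLp G, hG2.toLp _), fun φ hφ => ?_, fun p hp => ?_⟩
  · rw [← hval φ hφ]
    congr 1
    · refine integral_congr_ae ?_
      filter_upwards [hG1.coeFn_toLp] with z hz
      rw [hz]
    · refine integral_congr_ae ?_
      filter_upwards [hG2.coeFn_toLp] with x hx
      rw [hx]
  · obtain ⟨h1, h2⟩ := ae_eq_zero_of_forall_trace_eq_zero hLip hT
      ((Lp.memLp p.1).sub hG1) ((Lp.memLp p.2).sub hG2) fun φ hφ => by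
        have e1 := hp φ hφ
        rw [← hval φ hφ] at e1
        simp only [Pi.sub_apply, sub_mul, mul_sub]
        rw [integral_sub (integrable_memLp_top_mul (Lp.memLp p.1) (hφ.integrable _))
          (integrable_memLp_top_mul hG1 (hφ.integrable _)),
          integral_sub (hφv φ hφ _ (Lp.memLp p.2)) (hφv φ hφ _ hG2)]
        linarith
    refine Prod.ext ?_ ?_
    · ext1
      filter_upwards [h1, hG1.coeFn_toLp] with z h3 h4
      rw [h4]
      exact sub_eq_zero.1 h3
    · ext1
      filter_upwards [h2, hG2.coeFn_toLp] with z h3 h4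
      rw [h4]
      exact sub_eq_zero.1 h3

end Trace

theorem lemma3p3 {d : ℕ} (hd : 0 < d) (Ω : Set (EuclideanSpace ℝ (Fin d))) (hΩ : IsOpen Ω)
    (hLip : HasUniformlyLipschitzBoundary Ω) (T : ℝ) (hT : 0 < T)
    (b : ℝ × EuclideanSpace ℝ (Fin d) → EuclideanSpace ℝ (Fin d))
    (hb : MemLp b ∞ (volume.restrict (spaceTimeCylinder T Ω)))
    (μp μn : Measure (ℝ × EuclideanSpace ℝ (Fin d)))
    (hdiv : HasSpaceDivergence T Ω b μp μn) :
    (LocallyFiniteUpToBoundary T Ω μp → LocallyFiniteUpToBoundary T Ω μn →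
      ∃! trb : Lp ℝ ∞ (lateralMeasure T Ω), ∀ φ, IsTestFunctionUpToZero T φ →
        (∫ z, trb z * φ z ∂(lateralMeasure T Ω)) - ∫ x in Ω, φ (0, x) =
          (∫ z in spaceTimeCylinder T Ω, (timeDeriv φ z + spaceDeriv φ z (b z)))
            + ((∫ z in spaceTimeCylinder T Ω, φ z ∂μp) - ∫ z in spaceTimeCylinder T Ω, φ z ∂μn)) ∧
    ∀ w f : ℝ × EuclideanSpace ℝ (Fin d) → ℝ,
      MemLp w ∞ (volume.restrict (spaceTimeCylinder T Ω)) →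
      MemLp f ∞ (volume.restrict (spaceTimeCylinder T Ω)) →
      IsDistributionalSolution T Ω b w f →
      ∃! p : Lp ℝ ∞ (lateralMeasure T Ω) × Lp ℝ ∞ (volume.restrict Ω),
        ∀ φ, IsTestFunctionUpToZero T φ →
          (∫ z, p.1 z * φ z ∂(lateralMeasure T Ω)) - ∫ x in Ω, φ (0, x) * p.2 x =
            (∫ z in spaceTimeCylinder T Ω, w z * (timeDeriv φ z + spaceDeriv φ z (b z)))
              + ∫ z in spaceTimeCylinder T Ω, f z * φ z := by
  exact ⟨fun hμp hμn => existsUnique_normalTrace hΩ hLip hT hb hdiv hμp hμn,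
    fun w f hw hf hsol => existsUnique_lateral_initial_trace hΩ hLip hT hb hw hf hsol⟩
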